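/- Let $(M^n,\mathrm d\sigma^2)$ be a compact Riemannian manifold, $I\subset\mathbb R$ an open interval, $h:I\to\mathbb R$ a positive $C^2$ function with $\kappa:=h'/h>0$ on $I$, and let $\bar M=I\times M$ carry the warped metric $\mathrm dt^2+h(t)^2\,\mathrm d\sigma^2$. Let $\Gamma\subset\mathbb R^n$ be an open convex cone with vertex at the origin, containing the positive cone and invariant under permutations of the coordinates, and let $f:\Gamma\to\mathbb R$ be a positive, $C^1$, concave, symmetric function with $f_i=\partial f/\partial\lambda_i>0$ in $\Gamma$. Suppose that there are constants $\mu_1\ge\mu_2>0$, $c_0>0$ and a strictly increasing continuous function $\delta$ with $\delta(y)>0$ for $y\ge c_0$ such that $\sum_i f_i\ge\delta(f)$ and $\sum_i f_i\lambda_i\ge\delta(f)$ at every $\lambda\in\Gamma$ with $\mu_2\le f(\lambda)\le\mu_1$. Put $k(t)=f(\kappa(t),\dots,\kappa(t))$. Let $t_-<t_+$ be points of $I$ and let $\psi:\bar M\to\mathbb R$ be a positive $C^1$ function such that (a) $\psi(t,u)>k(t)$ for $t\in I$, $t\le t_-$, $u\in M$; (b) $\psi(t,u)<k(t)$ for $t\in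 I$, $t\ge t_+$, $u\in M$; (c) $\partial_t(h\psi)\le 0$ for $t_-<t<t_+$; and suppose that $\limsup_{\lambda\to\lambda_0}f(\lambda)\le\bar\psi_0$ for every $\lambda_0\in\partial\Gamma$, for some constant $\bar\psi_0$ smaller than the infimum of $\psi$ over $[t_-,t_+]\times M$. For a positive $C^1$ function $\phi$ on $I$ and $s\in[0,1]$ put $$\Psi(s,t,u)=s\,\psi(t,u)+(1-s)\,\phi(t)\,k(t).$$ Call $\phi$ allowed if $\phi>1$ for $t\le t_-$, $\phi<1$ for $t\ge t_+$, $\phi'<0$ on $I$, and $\partial_t\Psi+\kappa\Psi<0$ for all $s\in[0,1)$, $t_-<t<t_+$, $u\in M$. Call a $C^3$ function $z:M\to I$ an admissible solution of the equation with parameter $s$ if at every $u\in M$ the vector $\lambda$ of principal curvatures of the graph $\{(z(u),u)\}\subset\bar M$, taken with respect to the unit normal $N$ with $\langle N,\partial_t\rangle<0$, lies in $\Gamma$ and satisfies $f(\lambda)=\Psi(s,z(u),u)$, that is, $F(a_{ij}(z))=\Psi(s,z,u)$. Then there is a constant $C$ such that, for every allowed $\phi$, every $s\in[0,1]$ and every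 admissible solution $z$ of the equation with parameter $s$, one has $|\nabla' z|<C$ on $M$, where $\nabla' z$ is the gradient of $z$ in $(M,\mathrm d\sigma^2)$. Thus, for fixed $M$, $I$, $h$, $\Gamma$, $f$, the constant $C$ depends only on $t_-$, $t_+$ and $\psi$. -/

import Mathlib

open Set Filter Topology Manifold
open scoped ContDiff Bundle

noncomputable section

namespace WarpedGraph

/-- A smooth Riemannian metric `dσ²` on the `n`-manifold `M`. -/
abbrev Metric (n : ℕ) (M : Type*) [TopologicalSpace M] [ChartedSpace (EuclideanSpace ℝ (Fin n)) M]
    [IsManifold (𝓡 n) ∞ M] :=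
  Bundle.ContMDiffRiemannianMetric (𝓡 n) ∞ (EuclideanSpace ℝ (Fin n))
    (fun x : M => TangentSpace (𝓡 n) x)

/-! ### The curvature function `f` on the cone `Γ` -/

/-- `Γ` is an open convex cone with vertex at the origin in `ℝⁿ`, containing the positive cone and
invariant under permutations of the coordinates. -/
structure IsSymmetricCone {n : ℕ} (Γ : Set (Fin n → ℝ)) : Prop where
  isOpen : IsOpen Γ
  convex : Convex ℝ Γ
  smul_mem : ∀ c : ℝ, 0 < c → ∀ l ∈ Γ, c • l ∈ Γ
  positive_subset : {l : Fin n → ℝ | ∀ i, 0 < l i} ⊆ Γ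
  symmetric : ∀ (σ : Equiv.Perm (Fin n)), ∀ l ∈ Γ, l ∘ σ ∈ Γ

/-- The partial derivative `f_i = ∂f/∂λ_i` at `l`. -/
def partialDeriv {n : ℕ} (f : (Fin n → ℝ) → ℝ) (i : Fin n) (l : Fin n → ℝ) : ℝ :=
  fderiv ℝ f l (Pi.single i 1)

/-- `f` is a positive, differentiable, concave, symmetric function on `Γ` with `f_i > 0`. -/
structure IsCurvatureFunction {n : ℕ} (Γ : Set (Fin n → ℝ)) (f : (Fin n → ℝ) → ℝ) : Prop where
  contDiffOn : ContDiffOn ℝ 1 f Γ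
  pos : ∀ l ∈ Γ, 0 < f l
  concave : ConcaveOn ℝ Γ f
  symmetric : ∀ (σ : Equiv.Perm (Fin n)), ∀ l ∈ Γ, f (l ∘ σ) = f l
  partialDeriv_pos : ∀ l ∈ Γ, ∀ i, 0 < partialDeriv f i l

/-- The structural inequalities `∑ f_i ≥ δ(f)` and `∑ f_i λ_i ≥ δ(f)` on the set
`{λ ∈ Γ : μ₁ ≥ f(λ) ≥ μ₂}`, where `δ` is continuous and strictly increasing, and positive
on `[c₀, ∞)` for some `c₀ > 0`. -/
def StructureCondition {n : ℕ} (Γ : Set (Fin n → ℝ)) (f : (Fin n → ℝ) → ℝ) : Prop :=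
  ∃ (δ : ℝ → ℝ) (c₀ μ₁ μ₂ : ℝ),
    StrictMonoOn δ (Ioi 0) ∧ ContinuousOn δ (Ioi 0) ∧
    0 < c₀ ∧ (∀ y, c₀ ≤ y → 0 < δ y) ∧
    0 < μ₂ ∧ μ₂ ≤ μ₁ ∧
    ∀ l ∈ Γ, μ₂ ≤ f l → f l ≤ μ₁ →
      δ (f l) ≤ ∑ i, partialDeriv f i l ∧ δ (f l) ≤ ∑ i, partialDeriv f i l * l i

/-- `limsup_{λ → ∂Γ} f(λ) ≤ b`, the upper limit being taken at every point of `∂Γ`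
within `Γ`. -/
def BoundaryLimsupLE {n : ℕ} (Γ : Set (Fin n → ℝ)) (f : (Fin n → ℝ) → ℝ) (b : ℝ) : Prop :=
  ∀ l₀ ∈ frontier Γ, limsup (fun l => ((f l : ℝ) : EReal)) (𝓝[Γ] l₀) ≤ (b : EReal)

/-! ### The warped product and the homotopy -/

/-- `κ = h'/h`, the principal curvature of the leaves `{t} × M`. -/
def kappa (h : ℝ → ℝ) (t : ℝ) : ℝ := deriv h t / h t

/-- `k(t) = f(κ(t), …, κ(t))`. -/
def leafValue {n : ℕ} (f : (Fin n → ℝ) → ℝ) (h : ℝ → ℝ) (t : ℝ) : ℝ := f (fun _ => kappa h t)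

/-- `Ψ(s, t, u) = s ψ(t, u) + (1 - s) φ(t) k(t)`. -/
def homotopyRHS {n : ℕ} {M : Type*} (f : (Fin n → ℝ) → ℝ) (h : ℝ → ℝ) (ψ : ℝ → M → ℝ)
    (φ : ℝ → ℝ) (s t : ℝ) (u : M) : ℝ :=
  s * ψ t u + (1 - s) * (φ t * leafValue f h t)

/-- The functions `φ` that are allowed in the homotopy: positive, decreasing, `> 1` up to `tm`,
`< 1` from `tp` on, and such that `∂_t Ψ + κ Ψ < 0` on `tm < t < tp`. -/
structure IsHomotopyWeight {n : ℕ} {M : Type*} (I : Set ℝ) (f : (Fin n → ℝ) → ℝ) (h : ℝ → ℝ)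
    (ψ : ℝ → M → ℝ) (tm tp : ℝ) (φ : ℝ → ℝ) : Prop where
  contDiffOn : ContDiffOn ℝ 1 φ I
  pos : ∀ t ∈ I, 0 < φ t
  one_lt : ∀ t ∈ I, t ≤ tm → 1 < φ t
  lt_one : ∀ t ∈ I, tp ≤ t → φ t < 1
  deriv_neg : ∀ t ∈ I, deriv φ t < 0
  homotopy_neg : ∀ s ∈ Ico (0 : ℝ) 1, ∀ t ∈ Ioo tm tp, ∀ u : M,
    deriv (fun r => homotopyRHS f h ψ φ s r u) t + kappa h t * homotopyRHS f h ψ φ s t u < 0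

/-! ### Hypersurfaces in local coordinates -/

section Local

variable {V : Type*} [NormedAddCommGroup V] [NormedSpace ℝ V]

/-- Christoffel symbol of the first kind of a metric `G` on an open subset of `V`: the number
`⟨∇_v w, y⟩` at `p`, for constant vector fields `v`, `w`, `y` (Koszul formula). -/
def christoffel (G : V → V → V → ℝ) (p v w y : V) : ℝ :=
  (fderiv ℝ (fun q => G q w y) p v + fderiv ℝ (fun q => G q v y) p w
    - fderiv ℝ (fun q => G q v w) p y) / 2

variable {E : Type*} [NormedAddCommGroup E] [NormedSpace ℝ E]

/-- The metric induced by `G` on the hypersurface parametrised by `X`. -/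
def inducedMetric (G : V → V → V → ℝ) (X : E → V) (x v w : E) : ℝ :=
  G (X x) (fderiv ℝ X x v) (fderiv ℝ X x w)

/-- The second fundamental form `⟨∇_v dX(w), N⟩` of the hypersurface parametrised by `X`, with
respect to the unit normal vector `N` at `X x`; here `∇` is the Levi-Civita connection of `G`. -/
def secondFundamentalForm (G : V → V → V → ℝ) (X : E → V) (x : E) (N : V) (v w : E) : ℝ :=
  G (X x) (fderiv ℝ (fun y => fderiv ℝ X y w) x v) N
    + christoffel G (X x) (fderiv ℝ X x v) (fderiv ℝ X x w) N

end Local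

section Graph

variable {n : ℕ} {M : Type*} [TopologicalSpace M] [ChartedSpace (EuclideanSpace ℝ (Fin n)) M]
  [IsManifold (𝓡 n) ∞ M]

/-- The metric `dσ²` in the coordinates given by the chart `e` of `M`. -/
def chartMetric (g : Metric n M) (e : OpenPartialHomeomorph M (EuclideanSpace ℝ (Fin n)))
    (x v w : EuclideanSpace ℝ (Fin n)) : ℝ :=
  g.inner (e.symm x) (mfderiv (𝓡 n) (𝓡 n) e.symm x v) (mfderiv (𝓡 n) (𝓡 n) e.symm x w)

/-- The warped metric `dt² + h(t)² dσ²` in the coordinates `(t, x)` given by the chart `e`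
of `M`. -/
def warpedMetric (g : Metric n M) (h : ℝ → ℝ)
    (e : OpenPartialHomeomorph M (EuclideanSpace ℝ (Fin n)))
    (p v w : ℝ × EuclideanSpace ℝ (Fin n)) : ℝ :=
  v.1 * w.1 + h p.1 ^ 2 * chartMetric g e p.2 v.2 w.2

/-- The graph `X(u) = (z(u), u)` in the coordinates given by the chart `e`. -/
def graphMap (z : M → ℝ) (e : OpenPartialHomeomorph M (EuclideanSpace ℝ (Fin n)))
    (x : EuclideanSpace ℝ (Fin n)) : ℝ × EuclideanSpace ℝ (Fin n) :=
  (z (e.symm x), x)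

/-- `N` is the unit normal of the graph at the point with coordinate `x`, with `⟨N, ∂_t⟩ < 0`. -/
structure IsInwardNormal (g : Metric n M) (h : ℝ → ℝ) (z : M → ℝ)
    (e : OpenPartialHomeomorph M (EuclideanSpace ℝ (Fin n)))
    (x : EuclideanSpace ℝ (Fin n)) (N : ℝ × EuclideanSpace ℝ (Fin n)) : Prop where
  normal : ∀ v, warpedMetric g h e (graphMap z e x) N (fderiv ℝ (graphMap z e) x v) = 0
  unit : warpedMetric g h e (graphMap z e x) N N = 1
  inward : warpedMetric g h e (graphMap z e x) N (1, 0) < 0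

/-- `l = (λ₁, …, λ_n)` is the vector of principal curvatures of the graph of `z` at `(z u, u)`:
in every chart of `M` around `u`, some basis of the tangent space is orthonormal for the induced
metric and diagonalises the second fundamental form, with diagonal entries `λ_i`. -/
def IsPrincipalCurvatures (g : Metric n M) (h : ℝ → ℝ) (z : M → ℝ) (u : M)
    (l : Fin n → ℝ) : Prop :=
  ∀ e ∈ IsManifold.maximalAtlas (𝓡 n) ∞ M, u ∈ e.source →
    ∃ (N : ℝ × EuclideanSpace ℝ (Fin n)) (b : Fin n → EuclideanSpace ℝ (Fin n)),
      IsInwardNormal g h z e (e u) N ∧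
      (∀ i j, inducedMetric (warpedMetric g h e) (graphMap z e) (e u) (b i) (b j)
        = if i = j then 1 else 0) ∧
      (∀ i j, secondFundamentalForm (warpedMetric g h e) (graphMap z e) (e u) N (b i) (b j)
        = if i = j then l i else 0)

/-- `z : M → I` is an admissible solution of `F(B) = f(λ) = rhs(z(u), u)`: at each point the
principal curvatures of the graph lie in `Γ` and satisfy the equation. -/
structure IsSolution (I : Set ℝ) (g : Metric n M) (h : ℝ → ℝ) (Γ : Set (Fin n → ℝ))
    (f : (Fin n → ℝ) → ℝ) (rhs : ℝ → M → ℝ) (z : M → ℝ) : Prop where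
  contMDiff : ContMDiff (𝓡 n) 𝓘(ℝ, ℝ) 3 z
  mem : ∀ u, z u ∈ I
  equation : ∀ u, ∃ l ∈ Γ, IsPrincipalCurvatures g h z u l ∧ f l = rhs (z u) u

/-- The metric at `u` as a bilinear form on the tangent space. -/
def metricForm (g : Metric n M) (u : M) : LinearMap.BilinForm ℝ (TangentSpace (𝓡 n) u) :=
  LinearMap.mk₂ ℝ (fun v w => g.inner u v w) (by simp) (by simp) (by simp) (by simp)

theorem metricForm_nondegenerate (g : Metric n M) (u : M) : (metricForm g u).Nondegenerate := by
  have key : ∀ v : TangentSpace (𝓡 n) u, g.inner u v v = 0 → v = 0 := fun v hv => by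
    by_contra hne
    exact (g.pos u v hne).ne' hv
  exact ⟨fun v hv => key v (hv v), fun v hv => key v (hv v)⟩

/-- The gradient `∇'z` on `(M, g)`: the vector with `g(∇'z, v) = dz(v)` for all `v`. -/
def gradient (g : Metric n M) (z : M → ℝ) (u : M) : TangentSpace (𝓡 n) u :=
  haveI : FiniteDimensional ℝ (TangentSpace (𝓡 n) u) :=
    inferInstanceAs (FiniteDimensional ℝ (EuclideanSpace ℝ (Fin n)))
  ((metricForm g u).toDual (metricForm_nondegenerate g u)).symm
    (mfderiv (𝓡 n) 𝓘(ℝ, ℝ) z u).toLinearMap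

/-- `|∇'z|`. -/
def gradientNorm (g : Metric n M) (z : M → ℝ) (u : M) : ℝ :=
  √(g.inner u (gradient g z u) (gradient g z u))

end Graph

end WarpedGraph

end

/-! Choose `r` with `r' = 1/h` and put `v = r ∘ z`. Since `dt² + h² dσ² = h² (dr² + dσ²)`, the graph
is conformal to a graph in a Riemannian product. Its principal curvatures are `(h' - μ_i)/(h W)`,
where `W² = 1 + G`, `G = |∇v|²`, and the `μ_i` are the eigenvalues of the covariant Hessian of `v`
relative to `σ + dv ⊗ dv` (`localEquation_of_isPrincipalCurvatures`). Comparison with the leaves at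
the extrema of `z` confines `z` to `(t_-, t_+)` (`IsSolution.mem_Ioo`), so only bounds on a compact
interval enter.

The maximum principle is applied to `½ log (1 + G) + K v`. With `w = ∇v`, the second order condition
in a principal direction `a` contains the third derivative of `v` along `a, a, w`. Commuting
derivatives turns it into the rate of change of the Hessian entry `(a, a)` along `w`, at the price
of a curvature term (`IsLocalGradient.hessian_evolution`). Hence the equation has to be
differentiated only once, along `w`. The eigenvalues need not be differentiable for this: in a
moving orthonormal frame the diagonal entries of the curvature form are averages of permutations of
the eigenvalues, so by concavity the tangent plane of `f`, evaluated on these entries, lies above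
the right-hand side `Ψ` and touches it at the maximum point; the first derivatives therefore agree
(`IsCurvatureFunction.le_of_orthogonal`, `IsLocalGradient.equation_at_maximum`).

With `F = ∑ f_i` and `S = ∑ f_i λ_i` the result is `F (G (h h'' + K h' - C) - K²/4) - G h' h W S ≤ h
W D`, where `D` is the derivative of `Ψ` along `w`. The condition `∂_t Ψ + κ Ψ ≤ 0` bounds the right
side by `-G h' h W Ψ` plus a multiple of `G`. Concavity and positivity of `f` give `S ≤ Ψ` and
`f(1,…,1) ≤ (Ψ - S) + F`. So for large `G` the terms in `F` and `Ψ - S` together exceed `L f(1,…,1)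
G`, and a suitable choice of `L` and `K` is contradictory (`lt_of_maximum_inequality`). All
constants are fixed before `φ`, `s` and `z`, and comparing an arbitrary point with the maximum point
gives the uniform bound. -/

noncomputable section
namespace WarpedGraph

/-! ### Concave symmetric functions on a symmetric cone -/

section Cone

variable {n : ℕ} {Γ : Set (Fin n → ℝ)} {f : (Fin n → ℝ) → ℝ}

theorem fderiv_eq_sum_partialDeriv (f : (Fin n → ℝ) → ℝ) (l v : Fin n → ℝ) :
    fderiv ℝ f l v = ∑ i, partialDeriv f i l * v i := by
  conv_lhs => rw [← Finset.univ_sum_single v]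
  rw [map_sum]
  refine Finset.sum_congr rfl fun i _ => ?_
  have : (Pi.single i (v i) : Fin n → ℝ) = v i • Pi.single i (1 : ℝ) := by
    rw [← Pi.single_smul]; simp
  rw [this, map_smul, smul_eq_mul, mul_comm, partialDeriv]

/-- The tangent hyperplane of a concave function lies above its graph. -/
theorem IsCurvatureFunction.le_tangent (hΓ : IsSymmetricCone Γ) (hf : IsCurvatureFunction Γ f)
    {l₀ l : Fin n → ℝ} (hl₀ : l₀ ∈ Γ) (hl : l ∈ Γ) :
    f l ≤ f l₀ + ∑ i, partialDeriv f i l₀ * (l i - l₀ i) := by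
  have hd : HasFDerivAt f (fderiv ℝ f l₀) l₀ :=
    ((hf.contDiffOn.contDiffAt (hΓ.isOpen.mem_nhds hl₀)).differentiableAt (by simp)).hasFDerivAt
  have hline : HasDerivAt (fun t : ℝ => f (l₀ + t • (l - l₀))) (fderiv ℝ f l₀ (l - l₀)) 0 := by
    have h1 : HasDerivAt (fun t : ℝ => l₀ + t • (l - l₀)) (l - l₀) 0 := by
      simpa using ((hasDerivAt_id (0 : ℝ)).smul_const (l - l₀)).const_add l₀
    have h2 : HasFDerivAt f (fderiv ℝ f l₀) (l₀ + (0 : ℝ) • (l - l₀)) := by simpa using hd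
    exact h2.comp_hasDerivAt (0 : ℝ) h1
  have key : f l - f l₀ ≤ fderiv ℝ f l₀ (l - l₀) := by
    have hs := (hasDerivAt_iff_tendsto_slope_zero.1 hline).mono_left
      (nhdsWithin_mono _ (fun x hx => ne_of_gt hx) : 𝓝[>] (0 : ℝ) ≤ 𝓝[≠] 0)
    -- By concavity every difference quotient along the segment is at least `f l - f l₀`; the bound
    -- passes to the limit at `0⁺`.
    refine ge_of_tendsto hs ?_
    have h1 : ∀ᶠ t : ℝ in 𝓝[>] 0, t < 1 := nhdsWithin_le_nhds (gt_mem_nhds one_pos)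
    filter_upwards [h1, self_mem_nhdsWithin] with t ht1 ht0
    have ht0' : (0 : ℝ) < t := ht0
    have hc := hf.concave.2 hl₀ hl (by linarith : 0 ≤ 1 - t) ht0'.le (by ring)
    have e : l₀ + t • (l - l₀) = (1 - t) • l₀ + t • l := by module
    simp only [zero_add, zero_smul, add_zero, e, smul_eq_mul] at hc ⊢
    rw [inv_mul_eq_div, le_div_iff₀ ht0']
    linarith
  rw [fderiv_eq_sum_partialDeriv] at key
  simp only [Pi.sub_apply] at key
  linarith

theorem IsSymmetricCone.const_mem (hΓ : IsSymmetricCone Γ) {c : ℝ} (hc : 0 < c) :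
    (fun _ => c) ∈ Γ := hΓ.positive_subset fun _ => hc

/-- The tangent plane at `l` dominates `f (c • l) > 0` on the whole ray; let `c → 0`. This uses only
that `Γ` is a cone and `f` is concave and positive. -/
theorem IsCurvatureFunction.sum_mul_le (hΓ : IsSymmetricCone Γ) (hf : IsCurvatureFunction Γ f)
    {l : Fin n → ℝ} (hl : l ∈ Γ) : ∑ i, partialDeriv f i l * l i ≤ f l := by
  have key : ∀ c : ℝ, 0 < c → (1 - c) * ∑ i, partialDeriv f i l * l i ≤ f l := by
    intro c hc
    have h1 := hf.le_tangent hΓ hl (hΓ.smul_mem c hc l hl)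
    have h2 := hf.pos _ (hΓ.smul_mem c hc l hl)
    have e : ∑ i, partialDeriv f i l * ((c • l) i - l i)
        = (c - 1) * ∑ i, partialDeriv f i l * l i := by
      rw [Finset.mul_sum]
      refine Finset.sum_congr rfl fun i _ => ?_
      simp; ring
    rw [e] at h1
    linarith
  have ht : Tendsto (fun c : ℝ => (1 - c) * ∑ i, partialDeriv f i l * l i) (𝓝[>] 0)
      (𝓝 ((1 - 0) * ∑ i, partialDeriv f i l * l i)) :=
    ((continuous_const.sub continuous_id).mul continuous_const).continuousAt.tendsto.mono_left
      nhdsWithin_le_nhds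
  have := le_of_tendsto ht (eventually_mem_nhdsWithin.mono fun c hc => key c hc)
  simpa using this

/-- The tangent plane at `l`, evaluated at `(1,…,1)`. Together with `sum_mul_le` it says that `∑
f_i` and the defect `f - ∑ f_i λ_i ≥ 0` cannot both be small. -/
theorem IsCurvatureFunction.one_le_sum (hΓ : IsSymmetricCone Γ) (hf : IsCurvatureFunction Γ f)
    {l : Fin n → ℝ} (hl : l ∈ Γ) :
    f (fun _ => 1) ≤ f l - ∑ i, partialDeriv f i l * l i + ∑ i, partialDeriv f i l := by
  have h1 := hf.le_tangent hΓ hl (hΓ.const_mem one_pos)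
  have e : ∑ i, partialDeriv f i l * (1 - l i)
      = ∑ i, partialDeriv f i l - ∑ i, partialDeriv f i l * l i := by
    rw [← Finset.sum_sub_distrib]
    exact Finset.sum_congr rfl fun i _ => by ring
  linarith

theorem IsCurvatureFunction.mono (hΓ : IsSymmetricCone Γ) (hf : IsCurvatureFunction Γ f)
    {l l' : Fin n → ℝ} (hl : l ∈ Γ) (hl' : l' ∈ Γ) (hle : ∀ i, l i ≤ l' i) : f l ≤ f l' := by
  have h1 := hf.le_tangent hΓ hl' hl
  have h2 : ∑ i, partialDeriv f i l' * (l i - l' i) ≤ 0 :=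
    Finset.sum_nonpos fun i _ => mul_nonpos_of_nonneg_of_nonpos
      (hf.partialDeriv_pos l' hl' i).le (sub_nonpos.2 (hle i))
  linarith

/-- Averaging the eigenvalues with the squares of an orthogonal matrix stays in the cone and
does not decrease a symmetric concave function. -/
theorem IsCurvatureFunction.le_of_orthogonal (hΓ : IsSymmetricCone Γ)
    (hf : IsCurvatureFunction Γ f) {l : Fin n → ℝ} (hl : l ∈ Γ) (O : Matrix (Fin n) (Fin n) ℝ)
    (hO : O * O.transpose = 1) :
    (fun i => ∑ j, O i j ^ 2 * l j) ∈ Γ ∧ f l ≤ f (fun i => ∑ j, O i j ^ 2 * l j) := by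
  have hO' : O.transpose * O = 1 := mul_eq_one_comm.1 hO
  have hD : (Matrix.of fun i j => O i j ^ 2) ∈ doublyStochastic ℝ (Fin n) := by
    rw [mem_doublyStochastic_iff_sum]
    refine ⟨fun i j => by simpa using sq_nonneg (O i j), fun i => ?_, fun j => ?_⟩
    · have := congrFun (congrFun hO i) i
      simpa [Matrix.mul_apply, sq] using this
    · have := congrFun (congrFun hO' j) j
      simpa [Matrix.mul_apply, sq] using this
  -- Birkhoff: the squared entries of an orthogonal matrix are a convex combination of permutation
  -- matrices, so symmetry and concavity finish the argument.
  obtain ⟨w, hw0, hw1, hw⟩ := exists_eq_sum_perm_of_mem_doublyStochastic hD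
  have e : (fun i => ∑ j, O i j ^ 2 * l j) = ∑ σ : Equiv.Perm (Fin n), w σ • (l ∘ σ) := by
    ext i
    have h1 : ∀ j, O i j ^ 2 = ∑ σ : Equiv.Perm (Fin n), w σ * (σ.permMatrix ℝ) i j := by
      intro j
      have := congrFun (congrFun hw i) j
      simp only [Matrix.sum_apply, Matrix.smul_apply, smul_eq_mul, Matrix.of_apply] at this
      exact this.symm
    simp only [h1, Finset.sum_mul, Finset.sum_apply, Pi.smul_apply, Function.comp, smul_eq_mul]
    rw [Finset.sum_comm]
    refine Finset.sum_congr rfl fun σ _ => ?_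
    simp only [mul_assoc]
    rw [← Finset.mul_sum]
    congr 1
    simp [Equiv.Perm.permMatrix, PEquiv.toMatrix_apply, Equiv.toPEquiv_apply]
  rw [e]
  refine ⟨hΓ.convex.sum_mem (fun σ _ => hw0 σ) hw1 fun σ _ => hΓ.symmetric σ l hl, ?_⟩
  have := hf.concave.le_map_sum (t := Finset.univ) (w := w) (p := fun σ => l ∘ σ)
    (fun σ _ => hw0 σ) hw1 fun σ _ => hΓ.symmetric σ l hl
  refine le_trans (le_of_eq ?_) this
  simp only [hf.symmetric _ l hl, smul_eq_mul, ← Finset.sum_mul, hw1, one_mul]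

end Cone

/-! ### Calculus lemmas -/

/-- If `c > 0`, the second derivative test makes `0` a local minimum as well, so `F` is locally
constant and `c = 0`. -/
theorem _root_.IsLocalMax.second_deriv_nonpos {F F' : ℝ → ℝ} {c : ℝ} (hmax : IsLocalMax F 0)
    (hF : ∀ᶠ s in 𝓝 (0 : ℝ), HasDerivAt F (F' s) s) (hF' : HasDerivAt F' c 0) : c ≤ 0 := by
  by_contra hc
  push Not at hc
  have h0 : F' 0 = 0 := hmax.hasDerivAt_eq_zero hF.self_of_nhds
  have hd : deriv F =ᶠ[𝓝 0] F' := hF.mono fun s hs => hs.deriv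
  have hdd : deriv (deriv F) 0 = c := by rw [hd.deriv_eq, hF'.deriv]
  have hmin : IsLocalMin F 0 := isLocalMin_of_deriv_deriv_pos (by rw [hdd]; exact hc)
    (by rw [hd.self_of_nhds, h0]) hF.self_of_nhds.continuousAt
  have hconst : F =ᶠ[𝓝 0] fun _ => F 0 := by
    filter_upwards [hmax, hmin] with s h1 h2 using le_antisymm h1 h2
  have h1 : deriv F =ᶠ[𝓝 0] fun _ => 0 := by
    filter_upwards [hconst.eventuallyEq_nhds] with s hs
    rw [hs.deriv_eq, deriv_const]
  have : deriv (deriv F) 0 = 0 := by rw [h1.deriv_eq, deriv_const]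
  linarith

/-- Inverse function theorem for `X ↦ X * X` at `1`, whose derivative there is `2 • id`. The last
clause is local uniqueness of the root, which later makes the root of a symmetric matrix symmetric.
-/
theorem exists_local_sqrt (A : Type*) [NormedRing A] [NormedAlgebra ℝ A] [CompleteSpace A] :
    ∃ ρ : A → A, DifferentiableAt ℝ ρ 1 ∧ ρ 1 = 1 ∧ (∀ᶠ X in 𝓝 (1 : A), ρ X * ρ X = X) ∧
      ∀ᶠ X in 𝓝 (1 : A), ρ (X * X) = X := by
  let e : A ≃L[ℝ] A := ContinuousLinearEquiv.smulLeft (Units.mk0 (2 : ℝ) two_ne_zero)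
  have hsq : HasStrictFDerivAt (fun X : A => X * X) (e : A →L[ℝ] A) 1 := by
    have h := (hasStrictFDerivAt_id (𝕜 := ℝ) (1 : A)).mul' (hasStrictFDerivAt_id (𝕜 := ℝ) (1 : A))
    have he : (e : A →L[ℝ] A) = id (1 : A) • ContinuousLinearMap.id ℝ A
        + MulOpposite.op (id (1 : A)) • ContinuousLinearMap.id ℝ A := by
      ext X
      simp [e, two_smul, Units.smul_def]
    rw [he]
    exact h
  refine ⟨hsq.localInverse _ _ _, ?_, ?_, ?_, hsq.eventually_left_inverse⟩
  · have := hsq.to_localInverse.hasFDerivAt.differentiableAt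
    rwa [mul_one] at this
  · have := hsq.localInverse_apply_image
    rwa [mul_one] at this
  · have := hsq.eventually_right_inverse
    rwa [mul_one] at this

section Frame

open scoped Matrix.Norms.Operator

/-- A symmetric matrix function that is the identity at `0` has an inverse square root which is
differentiable at `0`. -/
theorem exists_differentiableAt_inverse_sqrt {n : ℕ} (G : ℝ → Matrix (Fin n) (Fin n) ℝ)
    (hG0 : G 0 = 1) (hsymm : ∀ᶠ s in 𝓝 0, (G s).transpose = G s)
    (hG : ∀ i j, DifferentiableAt ℝ (fun s => G s i j) 0) :
    ∃ P : ℝ → Matrix (Fin n) (Fin n) ℝ, P 0 = 1 ∧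
      (∀ i j, DifferentiableAt ℝ (fun s => P s i j) 0) ∧
      ∀ᶠ s in 𝓝 0, (P s).transpose * G s * P s = 1 := by
  let A := Matrix (Fin n) (Fin n) ℝ
  have entry : ∀ i j, IsBoundedLinearMap ℝ (fun X : A => X i j) := fun i j =>
    (LinearMap.toContinuousLinearMap
      (Matrix.entryLinearMap ℝ ℝ i j : A →ₗ[ℝ] ℝ)).isBoundedLinearMap
  have hGd : DifferentiableAt ℝ G 0 := by
    have : G = fun s => ∑ i, ∑ j, (G s i j) • (Matrix.single i j 1 : A) := by
      ext1 s
      conv_lhs => rw [Matrix.matrix_eq_sum_single (G s)]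
      refine Finset.sum_congr rfl fun i _ => Finset.sum_congr rfl fun j _ => ?_
      simp
    rw [this]
    refine DifferentiableAt.fun_sum fun i _ => DifferentiableAt.fun_sum fun j _ => ?_
    exact (hG i j).smul_const _
  obtain ⟨ρ, hρd, hρ1, hρr, hρl⟩ := exists_local_sqrt A
  let R : ℝ → A := fun s => ρ (G s)
  have hR0 : R 0 = 1 := by simp only [R, hG0, hρ1]
  have hRd : DifferentiableAt ℝ R 0 := DifferentiableAt.comp 0 (hG0 ▸ hρd) hGd
  have hRc : Tendsto R (𝓝 0) (𝓝 1) := by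
    have := hRd.continuousAt.tendsto; rwa [hR0] at this
  have hGc : Tendsto G (𝓝 0) (𝓝 (1 : A)) := by
    have := hGd.continuousAt.tendsto; rwa [hG0] at this
  have hRR : ∀ᶠ s in 𝓝 0, R s * R s = G s := hGc.eventually hρr
  -- The transpose of `R s` is another root of `G s` near `1`, so local uniqueness identifies the
  -- two.
  have hRt : ∀ᶠ s in 𝓝 0, (R s).transpose = R s := by
    have ht : Tendsto (fun s => (R s).transpose) (𝓝 0) (𝓝 (1 : A)) := by
      have : Continuous fun X : A => X.transpose := continuous_id.matrix_transpose
      have := (this.tendsto 1).comp hRc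
      rwa [Matrix.transpose_one] at this
    filter_upwards [hRR, ht.eventually hρl, hsymm] with s h1 h2 h3
    rw [← h2, ← Matrix.transpose_mul, h1, h3]
  have hunit : ∀ᶠ s in 𝓝 0, IsUnit (R s) := hRc.eventually (Units.nhds (1 : Aˣ))
  have h1u : IsUnit (R 0) := hR0 ▸ isUnit_one
  have hPd : DifferentiableAt ℝ (fun s => Ring.inverse (R s)) 0 :=
    (differentiableAt_inverse h1u).comp 0 hRd
  refine ⟨fun s => Ring.inverse (R s), by simp [hR0], fun i j => ?_, ?_⟩
  · exact (entry i j).differentiableAt.comp (0 : ℝ) hPd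
  · filter_upwards [hRR, hRt, hunit] with s h1 h2 h3
    have h4 : Ring.inverse (R s) * R s = 1 := Ring.inverse_mul_cancel _ h3
    have h5 : R s * Ring.inverse (R s) = 1 := Ring.mul_inverse_cancel _ h3
    have h6 : (Ring.inverse (R s)).transpose * R s = 1 := by
      rw [← h2, ← Matrix.transpose_mul, h2, h5, Matrix.transpose_one]
    rw [← h1, ← mul_assoc, h6, one_mul, h5]

end Frame

/-! ### Calculus of a metric on an open set of a vector space -/

section LocalMetric

variable {E : Type*} [NormedAddCommGroup E] [NormedSpace ℝ E]

instance : NormedAddCommGroup (E →L[ℝ] ℝ) := ContinuousLinearMap.toNormedAddCommGroup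
instance : NormedSpace ℝ (E →L[ℝ] ℝ) := ContinuousLinearMap.toNormedSpace
instance : NormedAddCommGroup (E →L[ℝ] E →L[ℝ] ℝ) := ContinuousLinearMap.toNormedAddCommGroup
instance : NormedSpace ℝ (E →L[ℝ] E →L[ℝ] ℝ) := ContinuousLinearMap.toNormedSpace
instance : NormedAddCommGroup (E →L[ℝ] E →L[ℝ] E →L[ℝ] ℝ) :=
  ContinuousLinearMap.toNormedAddCommGroup
instance : NormedSpace ℝ (E →L[ℝ] E →L[ℝ] E →L[ℝ] ℝ) := ContinuousLinearMap.toNormedSpace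

theorem hasDerivAt_line {F : Type*} [NormedAddCommGroup F] [NormedSpace ℝ F] {φ : E → F}
    (x a : E) (s : ℝ) (h : DifferentiableAt ℝ φ (x + s • a)) :
    HasDerivAt (fun r : ℝ => φ (x + r • a)) (fderiv ℝ φ (x + s • a) a) s := by
  have h1 : HasDerivAt (fun r : ℝ => x + r • a) a s := by
    simpa using ((hasDerivAt_id s).smul_const a).const_add x
  exact h.hasFDerivAt.comp_hasDerivAt s h1

theorem hasDerivAt_line_zero {F : Type*} [NormedAddCommGroup F] [NormedSpace ℝ F] {φ : E → F}
    (x a : E) (h : DifferentiableAt ℝ φ x) :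
    HasDerivAt (fun r : ℝ => φ (x + r • a)) (fderiv ℝ φ x a) 0 := by
  have := hasDerivAt_line x a 0 (φ := φ) (by simpa using h)
  simpa using this

theorem tendsto_line (x a : E) : Tendsto (fun s : ℝ => x + s • a) (𝓝 0) (𝓝 x) := by
  have : Continuous fun s : ℝ => x + s • a := by fun_prop
  simpa using this.tendsto 0

/-- The metric components and the derivatives of order at most three of `v` near `x`. -/
structure IsLocalGradient (σ : E → E →L[ℝ] E →L[ℝ] ℝ) (v : E → ℝ) (w : E → E) (x : E) : Prop where
  metric : ContDiffAt ℝ 2 σ x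
  symm : ∀ᶠ y in 𝓝 x, ∀ a b, σ y a b = σ y b a
  fn : ContDiffAt ℝ 3 v x
  grad : ContDiffAt ℝ 2 w x
  eq : ∀ᶠ y in 𝓝 x, σ y (w y) = fderiv ℝ v y

variable {σ : E → E →L[ℝ] E →L[ℝ] ℝ} {v : E → ℝ} {w : E → E} {x : E}

theorem _root_.ContDiffAt.fderiv_three {v : E → ℝ} {x : E} (h : ContDiffAt ℝ 3 v x) :
    ContDiffAt ℝ 2 (fderiv ℝ v) x := h.fderiv_right (by norm_num)

theorem IsLocalGradient.eventually (H : IsLocalGradient σ v w x) :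
    ∀ᶠ y in 𝓝 x, IsLocalGradient σ v w y := by
  filter_upwards [H.metric.eventually (by simp), H.symm.eventually_nhds,
    H.fn.eventually (by simp), H.grad.eventually (by simp), H.eq.eventually_nhds]
    with y h1 h2 h3 h4 h5 using ⟨h1, h2, h3, h4, h5⟩

theorem IsLocalGradient.hessian (H : IsLocalGradient σ v w x) :
    ContDiffAt ℝ 1 (fderiv ℝ (fderiv ℝ v)) x := H.fn.fderiv_three.fderiv_right (by norm_num)

theorem IsLocalGradient.metric_deriv (H : IsLocalGradient σ v w x) :
    ContDiffAt ℝ 1 (fderiv ℝ σ) x := H.metric.fderiv_right (by norm_num)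

/-- Derivative of the relation `σ w = dv`. -/
theorem IsLocalGradient.metric_fderiv_grad (H : IsLocalGradient σ v w x) (a y : E) :
    σ x (fderiv ℝ w x a) y = fderiv ℝ (fderiv ℝ v) x a y - fderiv ℝ σ x a (w x) y := by
  have h1 := hasDerivAt_line_zero x a (H.metric.differentiableAt (by simp))
  have h2 := hasDerivAt_line_zero x a (H.grad.differentiableAt (by simp))
  have h3 := hasDerivAt_line_zero x a (H.fn.fderiv_three.differentiableAt (by simp))
  have h4 := (h1.clm_apply h2)
  have h5 : (fun s : ℝ => σ (x + s • a) (w (x + s • a))) =ᶠ[𝓝 0]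
      fun s => fderiv ℝ v (x + s • a) := (tendsto_line x a).eventually H.eq
  have h6 := (h3.congr_of_eventuallyEq h5).unique h4
  simp only [zero_smul, add_zero] at h6
  rw [h6]
  simp

theorem IsLocalGradient.metric_deriv_symm (H : IsLocalGradient σ v w x) (c a b : E) :
    fderiv ℝ σ x c a b = fderiv ℝ σ x c b a := by
  have h1 := hasDerivAt_line_zero x c (H.metric.differentiableAt (by simp))
  have h2 := (h1.clm_apply (hasDerivAt_const (0 : ℝ) a)).clm_apply (hasDerivAt_const (0 : ℝ) b)
  have h3 := (h1.clm_apply (hasDerivAt_const (0 : ℝ) b)).clm_apply (hasDerivAt_const (0 : ℝ) a)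
  have h5 : (fun s : ℝ => σ (x + s • c) a b) =ᶠ[𝓝 0] fun s => σ (x + s • c) b a :=
    ((tendsto_line x c).eventually H.symm).mono fun s hs => hs a b
  have h6 := (h3.congr_of_eventuallyEq h5).unique h2
  simpa using h6.symm

theorem IsLocalGradient.hessian_symm (H : IsLocalGradient σ v w x) (a b : E) :
    fderiv ℝ (fderiv ℝ v) x a b = fderiv ℝ (fderiv ℝ v) x b a :=
  (H.fn.isSymmSndFDerivAt (by simp; norm_num)).eq a b

/-- Symmetry of the second derivative of `dv`, combined with the derivative of the symmetry of the
Hessian. It converts the term produced by the maximum condition into the derivative of the Hessian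
in the direction `b`, later the gradient. -/
theorem IsLocalGradient.third_symm (H : IsLocalGradient σ v w x) (a b : E) :
    fderiv ℝ (fderiv ℝ (fderiv ℝ v)) x a a b = fderiv ℝ (fderiv ℝ (fderiv ℝ v)) x b a a := by
  have h0 : fderiv ℝ (fderiv ℝ (fderiv ℝ v)) x a b = fderiv ℝ (fderiv ℝ (fderiv ℝ v)) x b a :=
    (H.fn.fderiv_three.isSymmSndFDerivAt (by simp)).eq a b
  have h1 := hasDerivAt_line_zero x a (H.hessian.differentiableAt (by simp))
  have h2 := (h1.clm_apply (hasDerivAt_const (0 : ℝ) a)).clm_apply (hasDerivAt_const (0 : ℝ) b)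
  have h3 := (h1.clm_apply (hasDerivAt_const (0 : ℝ) b)).clm_apply (hasDerivAt_const (0 : ℝ) a)
  have h5 : (fun s : ℝ => fderiv ℝ (fderiv ℝ v) (x + s • a) a b) =ᶠ[𝓝 0]
      fun s => fderiv ℝ (fderiv ℝ v) (x + s • a) b a :=
    ((tendsto_line x a).eventually H.eventually).mono fun s hs => hs.hessian_symm a b
  have h6 := (h3.congr_of_eventuallyEq h5).unique h2
  simp only [zero_smul, add_zero, map_zero] at h6
  rw [← h0]
  exact h6.symm

/-- `½ ∇_a |∇v|²` in terms of the Hessian. -/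
theorem IsLocalGradient.hasDerivAt_normSq (H : IsLocalGradient σ v w x) (a : E) :
    HasDerivAt (fun s : ℝ => fderiv ℝ v (x + s • a) (w (x + s • a)))
      (2 * fderiv ℝ (fderiv ℝ v) x a (w x) - fderiv ℝ σ x a (w x) (w x)) 0 := by
  have h2 := hasDerivAt_line_zero x a (H.grad.differentiableAt (by simp))
  have h3 := hasDerivAt_line_zero x a (H.fn.fderiv_three.differentiableAt (by simp))
  refine (h3.clm_apply h2).congr_deriv ?_
  simp only [zero_smul, add_zero]
  rw [← H.eq.self_of_nhds, H.symm.self_of_nhds, H.metric_fderiv_grad]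
  ring

/-- First and second order conditions at a maximum of `½ log (1 + |∇v|²) + K v`. -/
theorem IsLocalGradient.maximum_conditions (H : IsLocalGradient σ v w x) {K : ℝ}
    (hpos : 0 ≤ fderiv ℝ v x (w x))
    (hmax : IsLocalMax (fun y => Real.log (1 + fderiv ℝ v y (w y)) / 2 + K * v y) x) (a : E) :
    2 * fderiv ℝ (fderiv ℝ v) x a (w x) - fderiv ℝ σ x a (w x) (w x)
        = - (2 * K * (1 + fderiv ℝ v x (w x)) * fderiv ℝ v x a) ∧
      fderiv ℝ (fderiv ℝ (fderiv ℝ v)) x a a (w x)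
        - fderiv ℝ (fderiv ℝ σ) x a a (w x) (w x) / 2
        + σ x (fderiv ℝ w x a) (fderiv ℝ w x a)
        - 2 * K ^ 2 * (1 + fderiv ℝ v x (w x)) * fderiv ℝ v x a ^ 2
        + K * (1 + fderiv ℝ v x (w x)) * fderiv ℝ (fderiv ℝ v) x a a ≤ 0 := by
  set Q : ℝ → ℝ := fun s => 1 + fderiv ℝ v (x + s • a) (w (x + s • a)) with hQ
  set Q' : ℝ → ℝ := fun s => 2 * fderiv ℝ (fderiv ℝ v) (x + s • a) a (w (x + s • a))
    - fderiv ℝ σ (x + s • a) a (w (x + s • a)) (w (x + s • a)) with hQ'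
  -- The derivative at a nearby parameter `s` is the one at `0` for the line recentred at `x + s •
  -- a`.
  have hev : ∀ᶠ s : ℝ in 𝓝 0, HasDerivAt Q (Q' s) s := by
    filter_upwards [(tendsto_line x a).eventually H.eventually] with s hs
    have h1 := (hs.hasDerivAt_normSq a).const_add 1
    have h2 : HasDerivAt (fun r : ℝ => r - s) 1 s := by simpa using (hasDerivAt_id s).sub_const s
    have h1' : HasDerivAt (fun r : ℝ => 1 + fderiv ℝ v ((x + s • a) + r • a)
        (w ((x + s • a) + r • a))) (Q' s) (s - s) := by simpa [hQ'] using h1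
    have h3 := HasDerivAt.scomp (h := fun r => r - s) s h1' h2
    have h4 : Q = (fun r => 1 + fderiv ℝ v ((x + s • a) + r • a)
        (w ((x + s • a) + r • a))) ∘ fun r => r - s := by
      ext r
      have : x + s • a + (r - s) • a = x + r • a := by module
      simp only [Function.comp, this, hQ]
    rw [h4]
    exact h3.congr_deriv (one_smul _ _)
  have hQ0 : Q 0 = 1 + fderiv ℝ v x (w x) := by simp [hQ]
  have hQpos0 : 0 < Q 0 := by rw [hQ0]; linarith
  have hQpos : ∀ᶠ s : ℝ in 𝓝 0, 0 < Q s :=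
    hev.self_of_nhds.continuousAt.eventually (lt_mem_nhds hQpos0)
  have hF : ∀ᶠ s : ℝ in 𝓝 0, HasDerivAt (fun s => Real.log (Q s) / 2 + K * v (x + s • a))
      (Q' s / Q s / 2 + K * fderiv ℝ v (x + s • a) a) s := by
    filter_upwards [hev, hQpos, (tendsto_line x a).eventually H.eventually] with s h1 h2 h3
    exact ((h1.log h2.ne').div_const 2).add
      ((hasDerivAt_line x a s (h3.fn.differentiableAt (by simp))).const_mul K)
  have hmax' : IsLocalMax (fun s => Real.log (Q s) / 2 + K * v (x + s • a)) 0 := by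
    have := (tendsto_line x a).eventually hmax
    filter_upwards [this] with s hs
    simpa [hQ] using hs
  have hcrit := hmax'.hasDerivAt_eq_zero hF.self_of_nhds
  have hQ'0 : Q' 0 = 2 * fderiv ℝ (fderiv ℝ v) x a (w x) - fderiv ℝ σ x a (w x) (w x) := by
    simp [hQ']
  have d2 := hasDerivAt_line_zero x a (H.grad.differentiableAt (by simp))
  have d3 := (hasDerivAt_line_zero x a (H.hessian.differentiableAt (by simp))).clm_apply
    (hasDerivAt_const (0 : ℝ) a)
  have d4 := (hasDerivAt_line_zero x a (H.metric_deriv.differentiableAt (by simp))).clm_apply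
    (hasDerivAt_const (0 : ℝ) a)
  have dQ' : HasDerivAt Q' (2 * (fderiv ℝ (fderiv ℝ (fderiv ℝ v)) x a a (w x)
        - fderiv ℝ (fderiv ℝ σ) x a a (w x) (w x) / 2
        + σ x (fderiv ℝ w x a) (fderiv ℝ w x a))) 0 := by
    have := ((d3.clm_apply d2).const_mul 2).sub ((d4.clm_apply d2).clm_apply d2)
    refine this.congr_deriv ?_
    simp only [zero_smul, add_zero, map_zero, add_apply]
    rw [H.metric_fderiv_grad, H.metric_deriv_symm a (fderiv ℝ w x a) (w x)]
    ring
  have dv := hasDerivAt_line_zero x a (H.fn.fderiv_three.differentiableAt (by simp))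
  have hsecond := hmax'.second_deriv_nonpos hF (((dQ'.div hev.self_of_nhds hQpos0.ne').div_const
    2).add ((dv.clm_apply (hasDerivAt_const (0 : ℝ) a)).const_mul K))
  rw [← hQ0, ← hQ'0]
  simp only [zero_smul, add_zero, map_zero] at hcrit hsecond
  have hc : Q' 0 = -(2 * K * Q 0 * fderiv ℝ v x a) := by
    field_simp at hcrit
    linarith
  refine ⟨hc, ?_⟩
  rw [hc] at hsecond
  have e : ∀ A B P q : ℝ, q ≠ 0 → (2 * A * q - -(2 * K * q * P) * -(2 * K * q * P)) / q ^ 2 / 2 + K * B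
      = (A - 2 * K ^ 2 * q * P ^ 2 + K * q * B) / q := by
    intro A B P q hq; field_simp
  rw [e _ _ _ _ hQpos0.ne'] at hsecond
  have := (div_le_iff₀ hQpos0).1 hsecond
  linarith

end LocalMetric

/-! ### The covariant Hessian and its evolution along the gradient -/

section LocalMetric

variable {E : Type*} [NormedAddCommGroup E] [NormedSpace ℝ E]

/-- Christoffel symbol of the first kind, in terms of the derivative of the metric. -/
def chris (σ : E → E →L[ℝ] E →L[ℝ] ℝ) (x a b y : E) : ℝ :=
  (fderiv ℝ σ x a b y + fderiv ℝ σ x b a y - fderiv ℝ σ x y a b) / 2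

/-- Covariant Hessian of `v`, where `w` is the gradient of `v`. -/
def covHess (σ : E → E →L[ℝ] E →L[ℝ] ℝ) (v : E → ℝ) (w : E → E) (x a b : E) : ℝ :=
  fderiv ℝ (fderiv ℝ v) x a b - chris σ x a b (w x)

/-- The metric `σ + dv ⊗ dv`. -/
def graphForm (σ : E → E →L[ℝ] E →L[ℝ] ℝ) (v : E → ℝ) (x a b : E) : ℝ :=
  σ x a b + fderiv ℝ v x a * fderiv ℝ v x b

variable {σ : E → E →L[ℝ] E →L[ℝ] ℝ} {v : E → ℝ} {w : E → E} {x : E}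

/-- Evolution of the covariant Hessian along a line, on a moving vector. -/
theorem IsLocalGradient.hasDerivAt_covHess (H : IsLocalGradient σ v w x) (c : E) {A : ℝ → E}
    {a a' : E} (hA : HasDerivAt A a' 0) (hA0 : A 0 = a) :
    HasDerivAt (fun s : ℝ => covHess σ v w (x + s • c) (A s) (A s))
      (fderiv ℝ (fderiv ℝ (fderiv ℝ v)) x c a a
        - (fderiv ℝ (fderiv ℝ σ) x c a a (w x) - fderiv ℝ (fderiv ℝ σ) x c (w x) a a / 2)
        - chris σ x a a (fderiv ℝ w x c) + 2 * covHess σ v w x a' a) 0 := by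
  have dw := hasDerivAt_line_zero x c (H.grad.differentiableAt (by simp))
  have d3 := hasDerivAt_line_zero x c (H.hessian.differentiableAt (by simp))
  have d4 := hasDerivAt_line_zero x c (H.metric_deriv.differentiableAt (by simp))
  have h1 := (d3.clm_apply hA).clm_apply hA
  have h2 := ((d4.clm_apply hA).clm_apply hA).clm_apply dw
  have h3 := ((d4.clm_apply dw).clm_apply hA).clm_apply hA
  have h := h1.sub (((h2.add h2).sub h3).div_const 2)
  refine h.congr_deriv ?_
  simp only [zero_smul, add_zero, hA0, add_apply, covHess, chris]
  rw [H.metric_deriv_symm (w x) a' a, H.hessian_symm a a']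
  ring

theorem IsLocalGradient.graphForm_deriv (H : IsLocalGradient σ v w x) (c : E) {A B : ℝ → E}
    {a a' b b' : E} (hA : HasDerivAt A a' 0) (hA0 : A 0 = a) (hB : HasDerivAt B b' 0)
    (hB0 : B 0 = b) :
    HasDerivAt (fun s : ℝ => graphForm σ v (x + s • c) (A s) (B s))
      (fderiv ℝ σ x c a b + fderiv ℝ (fderiv ℝ v) x c a * fderiv ℝ v x b
        + fderiv ℝ v x a * fderiv ℝ (fderiv ℝ v) x c b
        + graphForm σ v x a' b + graphForm σ v x a b') 0 := by
  have d1 := hasDerivAt_line_zero x c (H.metric.differentiableAt (by simp))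
  have d2 := hasDerivAt_line_zero x c (H.fn.fderiv_three.differentiableAt (by simp))
  have h := ((d1.clm_apply hA).clm_apply hB).add ((d2.clm_apply hA).mul (d2.clm_apply hB))
  refine h.congr_deriv ?_
  simp only [zero_smul, add_zero, hA0, hB0, add_apply, graphForm]
  ring

/-- The evolution of an eigenvalue of the Hessian in the gradient direction, at a maximum of
`½ log (1 + |∇v|²) + K v`. -/
theorem IsLocalGradient.hessian_evolution (H : IsLocalGradient σ v w x) {K : ℝ}
    (hnonneg : ∀ a, 0 ≤ σ x a a)
    (hmax : IsLocalMax (fun y => Real.log (1 + fderiv ℝ v y (w y)) / 2 + K * v y) x)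
    (Γ : E → E → E) (hΓ : ∀ a b y, σ x (Γ a b) y = chris σ x a b y)
    {A : ℝ → E} {a a' : E} (hA : HasDerivAt A a' 0) (hA0 : A 0 = a)
    (hunit : ∀ᶠ s : ℝ in 𝓝 0, graphForm σ v (x + s • w x) (A s) (A s) = 1)
    {μ R : ℝ} (hμ : ∀ y, covHess σ v w x y a = μ * graphForm σ v x y a)
    (hR : -R ≤ -(fderiv ℝ (fderiv ℝ σ) x a a (w x) (w x)) / 2
      + fderiv ℝ (fderiv ℝ σ) x (w x) a a (w x) - fderiv ℝ (fderiv ℝ σ) x (w x) (w x) a a / 2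
      - σ x (Γ (w x) (w x)) (Γ a a)) :
    ∃ m', HasDerivAt (fun s : ℝ => covHess σ v w (x + s • w x) (A s) (A s)) m' 0 ∧
      μ ^ 2 + K * (1 + fderiv ℝ v x (w x)) * μ - R ≤ -m' := by
  have hG : 0 ≤ fderiv ℝ v x (w x) := by
    rw [← H.eq.self_of_nhds]; exact hnonneg _
  refine ⟨_, H.hasDerivAt_covHess (w x) hA hA0, ?_⟩
  have hunit0 : graphForm σ v x a a = 1 := by
    have := hunit.self_of_nhds
    simpa [hA0] using this
  have hua := ((hasDerivAt_const (0 : ℝ) (1 : ℝ)).congr_of_eventuallyEq hunit).unique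
    (H.graphForm_deriv (w x) hA hA0 hA hA0)
  obtain ⟨-, hsec⟩ := H.maximum_conditions hG hmax a
  have hcrit := fun b => (H.maximum_conditions hG hmax b).1
  have hgrad : ∀ y, σ x (w x) y = fderiv ℝ v x y := fun y => by rw [H.eq.self_of_nhds]
  have hσ := H.symm.self_of_nhds
  have hD := H.metric_deriv_symm
  have hv := H.hessian_symm
  have hη := H.metric_fderiv_grad
  rw [H.third_symm] at hsec
  set p := fderiv ℝ v x a
  set G := fderiv ℝ v x (w x)
  -- `σ(η, ·) = σ(ζ - Γ(a, w), ·)` with `ζ = μ (a + p w)`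
  have hη2 : ∀ y, σ x (fderiv ℝ w x a) y = σ x (μ • (a + p • w x) - Γ a (w x)) y := by
    intro y
    have h1 := hμ y
    simp only [covHess, graphForm, chris] at h1
    simp only [map_sub, map_smul, map_add, sub_apply, smul_apply, add_apply, smul_eq_mul, hη, hΓ,
      hgrad, chris]
    rw [hσ y a, hv y a, hD a y (w x), hD (w x) y a] at h1
    linarith
  have hηη : σ x (fderiv ℝ w x a) (fderiv ℝ w x a)
      = σ x (μ • (a + p • w x) - Γ a (w x)) (μ • (a + p • w x) - Γ a (w x)) := by
    rw [hη2, hσ, hη2]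
  -- The eigenvector equation tested on `w` is compared with the critical point condition in
  -- direction `a`: either `p = dv(a) = 0` or `μ = -K`.
  have e1 : μ * p * (1 + G) = - K * (1 + G) * p := by
    have h1 := hμ (w x)
    have h2 := hcrit a
    simp only [covHess, graphForm, chris, hgrad] at h1
    rw [hv (w x) a, hD (w x) (w x) a, hD a (w x) (w x)] at h1
    linarith
  have hpos : 0 < 1 + G := by linarith
  have e2 : μ * p = -K * p := by
    have : (μ * p - -K * p) * (1 + G) = 0 := by linarith
    have := (mul_eq_zero.1 this).resolve_right hpos.ne'
    linarith
  have hμa := hμ a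
  rw [hunit0, mul_one] at hμa
  have e3 : fderiv ℝ (fderiv ℝ v) x a a = μ + fderiv ℝ v x (Γ a a) := by
    rw [← hgrad, hσ, hΓ, ← hμa, covHess]
    ring
  have e4 : chris σ x a a (fderiv ℝ w x (w x))
      = -(K * (1 + G) * fderiv ℝ v x (Γ a a)) - σ x (Γ (w x) (w x)) (Γ a a) := by
    rw [← hΓ, hσ, hη, hΓ, hv, chris]
    have := hcrit (Γ a a)
    linarith
  have e5 : σ x (Γ a (w x)) a = fderiv ℝ σ x (w x) a a / 2 := by
    rw [hΓ, chris, hD a (w x) a]; ring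
  have e6 : fderiv ℝ v x (Γ a (w x)) = fderiv ℝ σ x a (w x) (w x) / 2 := by
    rw [← hgrad, hσ, hΓ, chris]; ring
  have e7 : fderiv ℝ (fderiv ℝ v) x (w x) a
      = - K * (1 + G) * p + fderiv ℝ v x (Γ a (w x)) := by
    rw [e6, hv]
    have := hcrit a
    linarith
  -- The frame velocity `a'` is paired only with the eigenvector `a`, so it enters only through the
  -- derivative of the normalisation `graphForm a a = 1`.
  have e8 : 2 * covHess σ v w x a' a
      = -(μ * (2 * σ x (Γ a (w x)) a + 2 * p * fderiv ℝ (fderiv ℝ v) x (w x) a)) := by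
    rw [hμ, e5]
    have h1 : graphForm σ v x a a' = graphForm σ v x a' a := by
      simp only [graphForm, hσ a a', mul_comm]
    rw [h1] at hua
    have : 2 * graphForm σ v x a' a = -(fderiv ℝ σ x (w x) a a
        + 2 * p * fderiv ℝ (fderiv ℝ v) x (w x) a) := by linarith
    linear_combination μ * this
  have hu : σ x a a = 1 - p ^ 2 := by
    simp only [graphForm] at hunit0
    linarith
  have e9 : σ x (μ • (a + p • w x) - Γ a (w x)) (μ • (a + p • w x) - Γ a (w x))
      = μ ^ 2 + K ^ 2 * p ^ 2 * (1 + G)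
        - 2 * μ * (σ x (Γ a (w x)) a + p * fderiv ℝ v x (Γ a (w x)))
        + σ x (Γ a (w x)) (Γ a (w x)) := by
    simp only [map_sub, map_smul, map_add, sub_apply, smul_apply, add_apply, smul_eq_mul,
      hgrad, hσ a (w x), hσ (Γ a (w x)) (w x), hσ a (Γ a (w x)), hu]
    have h1 : (μ * p) ^ 2 = K ^ 2 * p ^ 2 := by rw [e2]; ring
    linear_combination (1 + G) * h1
  have e10 : K * (1 + G) * p * (μ * p) = - K ^ 2 * (1 + G) * p ^ 2 := by rw [e2]; ring
  rw [hηη, e9, e3] at hsec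
  rw [e4, e8, e7]
  -- Two nonnegative terms are discarded: `σ(Γ(a,w), Γ(a,w))`, which is why `CurvatureBound` does
  -- not contain it, and what the identity `μ p = -K p` leaves of the quadratic terms in `p`.
  have := hnonneg (Γ a (w x))
  have : 0 ≤ K ^ 2 * p ^ 2 * (1 + G) := by positivity
  linarith

end LocalMetric

/-! ### Orthonormal frames and diagonalisation -/

section OrthonormalFrames

variable {n : ℕ} {E : Type*} [AddCommGroup E] [Module ℝ E]

theorem sum_of_orthonormal [FiniteDimensional ℝ E] (hn : Module.finrank ℝ E = n)
    (B : LinearMap.BilinForm ℝ E) {c : Fin n → E}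
    (hc : ∀ i j, B (c i) (c j) = if i = j then 1 else 0) (y : E) : y = ∑ j, B y (c j) • c j := by
  have key : ∀ (t : Fin n → ℝ) i, B (∑ j, t j • c j) (c i) = t i := by
    intro t i
    simp [map_sum, LinearMap.sum_apply, hc]
  have hli : LinearIndependent ℝ c := by
    rw [Fintype.linearIndependent_iff]
    intro t ht i
    rw [← key t i, ht]
    simp
  have hspan := hli.span_eq_top_of_card_eq_finrank' (by simp [hn])
  obtain ⟨t, ht⟩ := (Submodule.mem_span_range_iff_exists_fun ℝ).1
    (hspan ▸ Submodule.mem_top : y ∈ Submodule.span ℝ (Set.range c))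
  conv_lhs => rw [← ht]
  refine Finset.sum_congr rfl fun j _ => ?_
  rw [← ht, key]

/-- Expanding `y` in the frame shows that each frame vector is an eigenvector of `S` relative to
`B`. -/
theorem apply_of_diagonal [FiniteDimensional ℝ E] (hn : Module.finrank ℝ E = n)
    (B S : LinearMap.BilinForm ℝ E) {c : Fin n → E} {μ : Fin n → ℝ}
    (hc : ∀ i j, B (c i) (c j) = if i = j then 1 else 0)
    (hS : ∀ i j, S (c i) (c j) = if i = j then μ i else 0) (y : E) (j : Fin n) :
    S y (c j) = μ j * B y (c j) := by
  conv_lhs => rw [sum_of_orthonormal hn B hc y]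
  simp [map_sum, LinearMap.sum_apply, hS, mul_comm]

/-- Two orthonormal frames differ by an orthogonal matrix, and the diagonal of a form in one of
them is obtained from the diagonal in a diagonalising one with the squares of its entries. -/
theorem exists_orthogonal_of_orthonormal [FiniteDimensional ℝ E] (hn : Module.finrank ℝ E = n)
    (B S : LinearMap.BilinForm ℝ E) {c a : Fin n → E} {μ : Fin n → ℝ}
    (hc : ∀ i j, B (c i) (c j) = if i = j then 1 else 0)
    (hS : ∀ i j, S (c i) (c j) = if i = j then μ i else 0)
    (ha : ∀ i j, B (a i) (a j) = if i = j then 1 else 0) :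
    ∃ O : Matrix (Fin n) (Fin n) ℝ, O * O.transpose = 1 ∧
      (∀ i, ∑ j, O i j ^ 2 = 1) ∧ ∀ i, S (a i) (a i) = ∑ j, O i j ^ 2 * μ j := by
  have hO : (Matrix.of fun i j => B (a i) (c j)) * (Matrix.of fun i j => B (a i) (c j)).transpose
      = 1 := by
    ext i k
    rw [Matrix.one_apply, ← ha i k]
    conv_rhs => rw [sum_of_orthonormal hn B hc (a k)]
    simp [Matrix.mul_apply, mul_comm]
  refine ⟨Matrix.of fun i j => B (a i) (c j), hO, fun i => ?_, fun i => ?_⟩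
  · have := congrFun (congrFun hO i) i
    simpa [Matrix.mul_apply, sq] using this
  · have h1 : S (a i) (∑ j, B (a i) (c j) • c j) = ∑ j, B (a i) (c j) ^ 2 * μ j := by
      rw [map_sum]
      refine Finset.sum_congr rfl fun j _ => ?_
      rw [map_smul, apply_of_diagonal hn B S hc hS, smul_eq_mul]
      ring
    rw [← sum_of_orthonormal hn B hc (a i)] at h1
    simpa using h1

end OrthonormalFrames

/-! ### Moving orthonormal frames along a line -/

section LocalMetric

variable {E : Type*} [NormedAddCommGroup E] [NormedSpace ℝ E]
variable {σ : E → E →L[ℝ] E →L[ℝ] ℝ} {v : E → ℝ} {w : E → E} {x : E} {n : ℕ}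

def graphBilin (σ : E → E →L[ℝ] E →L[ℝ] ℝ) (v : E → ℝ) (x : E) : LinearMap.BilinForm ℝ E :=
  LinearMap.mk₂ ℝ (graphForm σ v x)
    (by intros; simp [graphForm]; ring) (by intros; simp [graphForm]; ring)
    (by intros; simp [graphForm]; ring) (by intros; simp [graphForm]; ring)

def hessBilin (σ : E → E →L[ℝ] E →L[ℝ] ℝ) (v : E → ℝ) (w : E → E) (x : E) :
    LinearMap.BilinForm ℝ E :=
  LinearMap.mk₂ ℝ (covHess σ v w x)
    (by intros; simp [covHess, chris]; ring) (by intros; simp [covHess, chris]; ring)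
    (by intros; simp [covHess, chris]; ring) (by intros; simp [covHess, chris]; ring)

/-- Correct the constant frame by the inverse square root of its Gram matrix. Orthonormality is
needed near `0`, differentiability only at `0`. -/
theorem IsLocalGradient.exists_frame (H : IsLocalGradient σ v w x) (c : E) {a : Fin n → E}
    (ha : ∀ i j, graphForm σ v x (a i) (a j) = if i = j then 1 else 0) :
    ∃ A : Fin n → ℝ → E, (∀ i, A i 0 = a i) ∧ (∀ i, DifferentiableAt ℝ (A i) 0) ∧
      ∀ᶠ s : ℝ in 𝓝 0, ∀ i j, graphForm σ v (x + s • c) (A i s) (A j s)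
        = if i = j then 1 else 0 := by
  obtain ⟨P, hP0, hPd, hP⟩ := exists_differentiableAt_inverse_sqrt
    (fun s => Matrix.of fun i j => graphForm σ v (x + s • c) (a i) (a j))
    (by ext i j; simp [ha, Matrix.one_apply])
    (by
      filter_upwards [(tendsto_line x c).eventually H.symm] with s hs
      ext i j
      simp [graphForm, hs (a j) (a i), mul_comm])
    (fun i j => (H.graphForm_deriv c (hasDerivAt_const (0 : ℝ) (a i)) rfl
      (hasDerivAt_const (0 : ℝ) (a j)) rfl).differentiableAt)
  refine ⟨fun i s => ∑ k, P s k i • a k, fun i => ?_, fun i => ?_, ?_⟩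
  · simp [hP0, Matrix.one_apply]
  · exact DifferentiableAt.fun_sum fun k _ => (hPd k i).smul_const _
  · filter_upwards [hP] with s hs i j
    have h1 := congrFun (congrFun hs i) j
    rw [Matrix.one_apply] at h1
    rw [← h1]
    change graphBilin σ v (x + s • c) _ _ = _
    simp only [map_sum, LinearMap.sum_apply, map_smul, LinearMap.smul_apply, smul_eq_mul,
      Matrix.mul_apply, Matrix.transpose_apply, Matrix.of_apply, Finset.sum_mul, Finset.mul_sum]
    refine Finset.sum_congr rfl fun k _ => Finset.sum_congr rfl fun m _ => ?_
    change P s k j * (P s m i * graphForm σ v (x + s • c) (a m) (a k)) = _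
    ring

end LocalMetric

/-! ### The equation in terms of `v`, differentiated at a maximum point -/

section LocalMetric

variable {E : Type*} [NormedAddCommGroup E] [NormedSpace ℝ E] [FiniteDimensional ℝ E]
variable {σ : E → E →L[ℝ] E →L[ℝ] ℝ} {v : E → ℝ} {w : E → E} {x : E} {n : ℕ}

/-- The equation `f(λ) = rhs` at `x`, where `λ` are the principal curvatures of the graph expressed
through the covariant Hessian of `v`; `h₀`, `h₁` are the values of `h`, `h'`. -/
def LocalEquation (Γ : Set (Fin n → ℝ)) (f : (Fin n → ℝ) → ℝ) (σ : E → E →L[ℝ] E →L[ℝ] ℝ)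
    (v : E → ℝ) (w : E → E) (h₀ h₁ rhs : ℝ) (x : E) : Prop :=
  ∃ l ∈ Γ, f l = rhs ∧ ∃ (c : Fin n → E) (μ : Fin n → ℝ),
    (∀ i j, graphForm σ v x (c i) (c j) = if i = j then 1 else 0) ∧
    (∀ i j, covHess σ v w x (c i) (c j) = if i = j then μ i else 0) ∧
    ∀ i, l i = (h₁ - μ i) / (h₀ * √(1 + fderiv ℝ v x (w x)))

/-- A bound for the part of the curvature of `σ` at `x` that enters the commutation formula. -/
def CurvatureBound (σ : E → E →L[ℝ] E →L[ℝ] ℝ) (x : E) (C : ℝ) : Prop :=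
  ∀ Γ : E → E → E, (∀ a b y, σ x (Γ a b) y = chris σ x a b y) → ∀ a w : E,
    -(C * σ x a a * σ x w w) ≤ -(fderiv ℝ (fderiv ℝ σ) x a a w w) / 2
      + fderiv ℝ (fderiv ℝ σ) x w a a w - fderiv ℝ (fderiv ℝ σ) x w w a a / 2
      - σ x (Γ w w) (Γ a a)

/-- A definite form identifies `E` with its dual in finite dimension, so the index of `chris` can be
raised; this gives `∇_a b` for constant fields. -/
theorem exists_christoffel (hpos : ∀ a, a ≠ 0 → 0 < σ x a a) :
    ∃ Γ : E → E → E, ∀ a b y, σ x (Γ a b) y = chris σ x a b y := by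
  have hinj : Function.Injective (σ x) := by
    rw [injective_iff_map_eq_zero]
    intro a ha
    by_contra hne
    have := hpos a hne
    simp [ha] at this
  have hsurj : Function.Surjective (σ x : E →ₗ[ℝ] E →L[ℝ] ℝ) := by
    rw [← LinearMap.injective_iff_surjective_of_finrank_eq_finrank]
    · exact hinj
    · rw [← (LinearMap.toContinuousLinearMap : (E →ₗ[ℝ] ℝ) ≃ₗ[ℝ] (E →L[ℝ] ℝ)).finrank_eq]
      exact (Subspace.dual_finrank_eq (K := ℝ) (V := E)).symm
  have : ∀ a b, ∃ z : E, ∀ y, σ x z y = chris σ x a b y := by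
    intro a b
    let L : E →ₗ[ℝ] ℝ :=
      { toFun := chris σ x a b
        map_add' := by intros; simp [chris]; ring
        map_smul' := by intros; simp [chris]; ring }
    obtain ⟨z, hz⟩ := hsurj (LinearMap.toContinuousLinearMap L)
    exact ⟨z, fun y => by
      exact congrArg (fun T : E →L[ℝ] ℝ => T y) hz⟩
  choose Γ hΓ using this
  exact ⟨Γ, hΓ⟩

/-- The differentiated equation at a maximum of `½ log (1 + |∇v|²) + K v`. -/
theorem IsLocalGradient.equation_at_maximum (hn : Module.finrank ℝ E = n)
    {Γ : Set (Fin n → ℝ)} {f : (Fin n → ℝ) → ℝ} (hΓ : IsSymmetricCone Γ)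
    (hf : IsCurvatureFunction Γ f) (H : IsLocalGradient σ v w x)
    (hpos : ∀ a, a ≠ 0 → 0 < σ x a a) {K C h h' h'' D : ℝ} (hh : 0 < h) (hC : 0 ≤ C)
    (hmax : IsLocalMax (fun y => Real.log (1 + fderiv ℝ v y (w y)) / 2 + K * v y) x)
    (hcurv : CurvatureBound σ x C) {h₀ h₁ Ψ : ℝ → ℝ}
    (hd₀ : HasDerivAt h₀ (h * h' * fderiv ℝ v x (w x)) 0) (h₀0 : h₀ 0 = h)
    (hd₁ : HasDerivAt h₁ (h * h'' * fderiv ℝ v x (w x)) 0) (h₁0 : h₁ 0 = h')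
    (hdΨ : HasDerivAt Ψ D 0)
    (heq : ∀ᶠ s : ℝ in 𝓝 0, LocalEquation Γ f σ v w (h₀ s) (h₁ s) (Ψ s) (x + s • w x)) :
    ∃ l ∈ Γ, f l = Ψ 0 ∧
      (∑ i, partialDeriv f i l) * (fderiv ℝ v x (w x) * (h * h'' + K * h' - C) - K ^ 2 / 4)
        - fderiv ℝ v x (w x) * h' * h * √(1 + fderiv ℝ v x (w x))
          * ∑ i, partialDeriv f i l * l i
        ≤ h * √(1 + fderiv ℝ v x (w x)) * D := by
  have hnonneg : ∀ a, 0 ≤ σ x a a := fun a => by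
    rcases eq_or_ne a 0 with rfl | ha
    · simp
    · exact (hpos a ha).le
  have hgw : σ x (w x) (w x) = fderiv ℝ v x (w x) := by rw [H.eq.self_of_nhds]
  obtain ⟨Γc, hΓc⟩ := exists_christoffel (x := x) hpos
  obtain ⟨l, hl, hfl, a, μ, ha, hμ, hla⟩ := heq.self_of_nhds
  simp only [zero_smul, add_zero, h₁0, h₀0] at ha hμ hla
  refine ⟨l, hl, hfl, ?_⟩
  obtain ⟨A, hA0, hAd, hA⟩ := H.exists_frame (w x) ha
  have hcrit := (H.maximum_conditions (by rw [← hgw]; exact hnonneg _) hmax (w x)).1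
  set G := fderiv ℝ v x (w x) with hG
  have hG0 : 0 ≤ G := by rw [← hgw]; exact hnonneg _
  set W := √(1 + G) with hW
  have hW2 : W ^ 2 = 1 + G := Real.sq_sqrt (by linarith)
  have hWpos : 0 < W := Real.sqrt_pos.2 (by linarith)
  have evo : ∀ i, ∃ m', HasDerivAt (fun s : ℝ => covHess σ v w (x + s • w x) (A i s) (A i s)) m' 0 ∧
      μ i ^ 2 + K * (1 + G) * μ i - C * G ≤ -m' := by
    intro i
    refine H.hessian_evolution hnonneg hmax Γc hΓc (hAd i).hasDerivAt (hA0 i) ?_ ?_ ?_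
    · filter_upwards [hA] with s hs
      simpa using hs i i
    · intro y
      exact apply_of_diagonal hn (graphBilin σ v x) (hessBilin σ v w x) ha hμ y i
    -- The curvature bound is quadratic in `a i`, and `σ(a i, a i) ≤ 1` because `a i` is a unit
    -- vector for the larger form `σ + dv ⊗ dv`.
    · refine le_trans ?_ (hcurv Γc hΓc (a i) (w x))
      rw [hgw]
      have h1 : graphForm σ v x (a i) (a i) = 1 := by simpa using ha i i
      have h2 : σ x (a i) (a i) ≤ 1 := by
        simp only [graphForm] at h1
        nlinarith [mul_self_nonneg (fderiv ℝ v x (a i))]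
      have := mul_le_mul_of_nonneg_left h2 (mul_nonneg hC hG0)
      linarith
  choose m' hm' hm'le using evo
  -- The derivative of `W` along the gradient is read off from the critical point condition in
  -- direction `w`.
  have dQ : HasDerivAt (fun s : ℝ => √(1 + fderiv ℝ v (x + s • w x) (w (x + s • w x))))
      (-(K * G * W)) 0 := by
    have h1 := ((H.hasDerivAt_normSq (w x)).const_add 1).sqrt (by simp; linarith)
    refine h1.congr_deriv ?_
    rw [hcrit]
    simp only [zero_smul, add_zero, ← hG, ← hW]
    rw [← hW2]
    field_simp
  set q : Fin n → ℝ → ℝ := fun i s => (h₁ s - covHess σ v w (x + s • w x) (A i s) (A i s))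
    / (h₀ s * √(1 + fderiv ℝ v (x + s • w x) (w (x + s • w x)))) with hq
  have hqd : ∀ i, HasDerivAt (q i)
      (((h * h'' * G - m' i) * (h * W) - (h' - μ i) * (h * h' * G * W + h * -(K * G * W)))
        / (h * W) ^ 2) 0 := by
    intro i
    have h1 := (hd₁.sub (hm' i)).div (hd₀.mul dQ) (by
      simp only [Pi.mul_apply, zero_smul, add_zero, h₀0]
      exact (mul_pos hh hWpos).ne')
    refine h1.congr_deriv ?_
    have h2 : covHess σ v w x (a i) (a i) = μ i := by simpa using hμ i i
    simp only [Pi.mul_apply, Pi.sub_apply, zero_smul, add_zero, h₀0, h₁0, hA0, h2, ← hG, ← hW]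
  have hq0 : ∀ i, q i 0 = l i := by
    intro i
    have h2 : covHess σ v w x (a i) (a i) = μ i := by simpa using hμ i i
    simp only [hq, zero_smul, add_zero, h₀0, h₁0, hA0, h2, hla, ← hG, ← hW]
  -- The `q i s` are diagonal entries in the moving frame, hence averages of the principal
  -- curvatures at `x + s • w x`. The averaging inequality and then the tangent plane at `l` give
  -- the bound, with equality at `s = 0`.
  have htouch : ∀ᶠ s : ℝ in 𝓝 0, Ψ s ≤ f l + ∑ i, partialDeriv f i l * (q i s - l i) := by
    filter_upwards [heq, hA] with s hs hAs
    obtain ⟨l', hl', hfl', c, ν, hc, hν, hlc⟩ := hs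
    obtain ⟨O, hO, hO1, hO2⟩ := exists_orthogonal_of_orthonormal hn
      (graphBilin σ v (x + s • w x)) (hessBilin σ v w (x + s • w x)) hc hν hAs
    obtain ⟨h1, h2⟩ := hf.le_of_orthogonal hΓ hl' O hO
    have h3 : (fun i => ∑ j, O i j ^ 2 * l' j) = fun i => q i s := by
      ext i
      simp only [hlc, mul_div_assoc', ← Finset.sum_div, hq]
      congr 1
      have : covHess σ v w (x + s • w x) (A i s) (A i s) = ∑ j, O i j ^ 2 * ν j := hO2 i
      rw [this]
      simp only [mul_sub, Finset.sum_sub_distrib, ← Finset.sum_mul, hO1, one_mul]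
    rw [h3] at h1 h2
    rw [← hfl']
    exact h2.trans (hf.le_tangent hΓ hl h1)
  have hmin : IsLocalMin (fun s => f l + ∑ i, partialDeriv f i l * (q i s - l i) - Ψ s) 0 := by
    filter_upwards [htouch] with s hs
    simp only [hq0, sub_self, mul_zero, Finset.sum_const_zero, add_zero, hfl]
    rw [hfl] at hs
    linarith
  have hd := hmin.hasDerivAt_eq_zero (((HasDerivAt.fun_sum fun i _ =>
    ((hqd i).sub_const (l i)).const_mul (partialDeriv f i l)).const_add (f l)).sub hdΨ)
  have hD : D = ∑ i, partialDeriv f i l * (((h * h'' * G - m' i) * (h * W)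
      - (h' - μ i) * (h * h' * G * W + h * -(K * G * W))) / (h * W) ^ 2) := by linarith
  rw [hD, Finset.mul_sum, Finset.sum_mul, Finset.mul_sum, ← Finset.sum_sub_distrib]
  refine Finset.sum_le_sum fun i _ => ?_
  have e : h * W * (partialDeriv f i l * (((h * h'' * G - m' i) * (h * W)
      - (h' - μ i) * (h * h' * G * W + h * -(K * G * W))) / (h * W) ^ 2))
      = partialDeriv f i l * (h * h'' * G - m' i - (h' - μ i) * (h' - K) * G) := by
    field_simp
    ring
  have e2 : μ i = h' - h * W * l i := by
    rw [hla]; field_simp; ring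
  rw [e]
  have e3 : partialDeriv f i l * (G * (h * h'' + K * h' - C) - K ^ 2 / 4)
      - G * h' * h * W * (partialDeriv f i l * l i)
      = partialDeriv f i l * (G * (h * h'' + K * h' - C) - K ^ 2 / 4 - G * h' * (h * W * l i)) := by
    ring
  rw [e3]
  refine mul_le_mul_of_nonneg_left ?_ (hf.partialDeriv_pos l hl i).le
  have e4 : h * W * l i = h' - μ i := by linarith
  rw [e4]
  have := hm'le i
  -- The `K G μ i` from the Hessian evolution cancels against the one from differentiating `W`. What
  -- remains is `μ² + K μ ≥ -K²/4`.
  nlinarith [sq_nonneg (μ i + K / 2)]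

end LocalMetric

/-! ### Locally uniform bounds on the metric and its curvature -/

section LocalBounds

variable {E : Type*} [NormedAddCommGroup E] [NormedSpace ℝ E]
variable {σ : E → E →L[ℝ] E →L[ℝ] ℝ} {x : E}

/-- The minimum over the unit sphere gives a constant `m` at `x`; half of it survives a perturbation
of norm less than `m / 2`. -/
theorem eventually_coercive [FiniteDimensional ℝ E] (hσ : ContinuousAt σ x)
    (hpos : ∀ a, a ≠ 0 → 0 < σ x a a) :
    ∃ c : ℝ, 0 < c ∧ ∀ᶠ y in 𝓝 x, ∀ a, c * ‖a‖ ^ 2 ≤ σ y a a := by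
  obtain ⟨m, hm, hmin⟩ : ∃ m : ℝ, 0 < m ∧ ∀ a : E, ‖a‖ = 1 → m ≤ σ x a a := by
    rcases (Metric.sphere (0 : E) 1).eq_empty_or_nonempty with h | h
    · refine ⟨1, one_pos, fun a ha => ?_⟩
      exact absurd (mem_sphere_zero_iff_norm.2 ha) (h ▸ Set.notMem_empty a)
    · have hc : Continuous fun a : E => σ x a a := by fun_prop
      obtain ⟨a₀, ha₀, hmin⟩ := (isCompact_sphere (0 : E) 1).exists_isMinOn h hc.continuousOn
      refine ⟨σ x a₀ a₀, hpos _ ?_, fun a ha => hmin (mem_sphere_zero_iff_norm.2 ha)⟩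
      rintro rfl
      simp at ha₀
  have hq : ∀ a : E, m * ‖a‖ ^ 2 ≤ σ x a a := by
    intro a
    rcases eq_or_ne a 0 with rfl | ha
    · simp
    · have hn : 0 < ‖a‖ := norm_pos_iff.2 ha
      have h1 := hmin (‖a‖⁻¹ • a) (by rw [norm_smul, norm_inv, norm_norm, inv_mul_cancel₀ hn.ne'])
      simp only [map_smul, smul_apply, smul_eq_mul] at h1
      have h2 : ‖a‖⁻¹ * (‖a‖⁻¹ * σ x a a) = σ x a a / ‖a‖ ^ 2 := by field_simp
      rw [h2, le_div_iff₀ (by positivity)] at h1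
      exact h1
  refine ⟨m / 2, by positivity, ?_⟩
  have h1 : ∀ᶠ y in 𝓝 x, ‖σ y - σ x‖ < m / 2 := by
    have h0 : ContinuousAt (fun y => ‖σ y - σ x‖) x := (hσ.sub continuousAt_const).norm
    refine h0.eventually (gt_mem_nhds ?_)
    simpa using hm
  filter_upwards [h1] with y hy a
  have h2 : |(σ y - σ x) a a| ≤ m / 2 * ‖a‖ * ‖a‖ := by
    refine ((σ y - σ x) a).le_of_opNorm_le ?_ a
    exact ((σ y - σ x).le_opNorm a).trans (by gcongr)
  have h3 := (abs_le.1 h2).1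
  simp only [sub_apply] at h3
  nlinarith [hq a]

theorem abs_chris_le {B : ℝ} (hB : ‖fderiv ℝ σ x‖ ≤ B) (a b y : E) :
    |chris σ x a b y| ≤ 3 / 2 * B * ‖a‖ * ‖b‖ * ‖y‖ := by
  have key : ∀ a b y : E, |fderiv ℝ σ x a b y| ≤ B * ‖a‖ * ‖b‖ * ‖y‖ := by
    intro a b y
    refine (fderiv ℝ σ x a b).le_of_opNorm_le ?_ y
    refine (fderiv ℝ σ x a).le_of_opNorm_le ?_ b
    exact (fderiv ℝ σ x).le_of_opNorm_le hB a
  have h1 := abs_le.1 (key a b y)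
  have h2 := abs_le.1 (key b a y)
  have h3 := abs_le.1 (key y a b)
  rw [chris, abs_le]
  constructor <;> nlinarith

/-- The three second derivative terms have coefficients `1/2 + 1 + 1/2`, hence `2 * B`. Testing `Γ a
a` against itself gives `‖Γ a a‖ ≤ 3B‖a‖²/(2c)`, hence the term `9/4 * B ^ 2 / c`; dividing by `c ^
2` replaces norms by `σ`. -/
theorem curvatureBound_of_norm_le {B c : ℝ} (hB0 : 0 ≤ B) (hc : 0 < c)
    (hB : ‖fderiv ℝ σ x‖ ≤ B) (hB2 : ‖fderiv ℝ (fderiv ℝ σ) x‖ ≤ B)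
    (hpos : ∀ a, c * ‖a‖ ^ 2 ≤ σ x a a) :
    CurvatureBound σ x ((2 * B + 9 / 4 * B ^ 2 / c) / c ^ 2) := by
  intro Γ hΓ a w
  have key : ∀ p q a b : E,
      |fderiv ℝ (fderiv ℝ σ) x p q a b| ≤ B * ‖p‖ * ‖q‖ * ‖a‖ * ‖b‖ := by
    intro p q a b
    refine (fderiv ℝ (fderiv ℝ σ) x p q a).le_of_opNorm_le ?_ b
    refine (fderiv ℝ (fderiv ℝ σ) x p q).le_of_opNorm_le ?_ a
    refine (fderiv ℝ (fderiv ℝ σ) x p).le_of_opNorm_le ?_ q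
    exact (fderiv ℝ (fderiv ℝ σ) x).le_of_opNorm_le hB2 p
  have h1 := (abs_le.1 (key a a w w)).2
  have h2 := (abs_le.1 (key w a a w)).1
  have h3 := (abs_le.1 (key w w a a)).2
  have h4 : c * ‖Γ a a‖ ≤ 3 / 2 * B * ‖a‖ ^ 2 := by
    rcases eq_or_ne (‖Γ a a‖) 0 with h0 | h0
    · rw [h0]; simp; positivity
    · have hp : 0 < ‖Γ a a‖ := lt_of_le_of_ne (norm_nonneg _) (Ne.symm h0)
      have h5 := hpos (Γ a a)
      rw [hΓ] at h5
      have h6 := (abs_le.1 (abs_chris_le hB a a (Γ a a))).2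
      have : (c * ‖Γ a a‖) * ‖Γ a a‖ ≤ (3 / 2 * B * ‖a‖ ^ 2) * ‖Γ a a‖ := by nlinarith
      exact le_of_mul_le_mul_right this hp
  have h5 : σ x (Γ w w) (Γ a a) ≤ 9 / 4 * B ^ 2 / c * ‖a‖ ^ 2 * ‖w‖ ^ 2 := by
    rw [hΓ]
    refine (abs_le.1 (abs_chris_le hB w w (Γ a a))).2.trans ?_
    have h6 : ‖Γ a a‖ ≤ 3 / 2 * B * ‖a‖ ^ 2 / c := by rw [le_div_iff₀ hc]; linarith
    calc 3 / 2 * B * ‖w‖ * ‖w‖ * ‖Γ a a‖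
        ≤ 3 / 2 * B * ‖w‖ * ‖w‖ * (3 / 2 * B * ‖a‖ ^ 2 / c) := by gcongr
      _ = _ := by ring
  have h6 : ‖a‖ ^ 2 * ‖w‖ ^ 2 ≤ σ x a a * σ x w w / c ^ 2 := by
    rw [le_div_iff₀ (by positivity)]
    have := mul_le_mul (hpos a) (hpos w) (by positivity)
      (le_trans (by positivity) (hpos a))
    calc _ = c * ‖a‖ ^ 2 * (c * ‖w‖ ^ 2) := by ring
      _ ≤ _ := this
  have h7 : (2 * B + 9 / 4 * B ^ 2 / c) * (‖a‖ ^ 2 * ‖w‖ ^ 2)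
      ≤ (2 * B + 9 / 4 * B ^ 2 / c) * (σ x a a * σ x w w / c ^ 2) := by gcongr
  have h8 : (2 * B + 9 / 4 * B ^ 2 / c) / c ^ 2 * σ x a a * σ x w w
      = (2 * B + 9 / 4 * B ^ 2 / c) * (σ x a a * σ x w w / c ^ 2) := by ring
  rw [h8]
  have e1 : B * ‖a‖ * ‖a‖ * ‖w‖ * ‖w‖ = B * (‖a‖ ^ 2 * ‖w‖ ^ 2) := by ring
  have e2 : B * ‖w‖ * ‖a‖ * ‖a‖ * ‖w‖ = B * (‖a‖ ^ 2 * ‖w‖ ^ 2) := by ring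
  have e3 : B * ‖w‖ * ‖w‖ * ‖a‖ * ‖a‖ = B * (‖a‖ ^ 2 * ‖w‖ ^ 2) := by ring
  have e4 : 9 / 4 * B ^ 2 / c * ‖a‖ ^ 2 * ‖w‖ ^ 2
      = 9 / 4 * B ^ 2 / c * (‖a‖ ^ 2 * ‖w‖ ^ 2) := by ring
  rw [e1] at h1
  rw [e2] at h2
  rw [e3] at h3
  rw [e4] at h5
  linarith

theorem eventually_curvatureBound [FiniteDimensional ℝ E] (hσ : ContDiffAt ℝ 2 σ x)
    (hpos : ∀ a, a ≠ 0 → 0 < σ x a a) :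
    ∃ C : ℝ, 0 ≤ C ∧ ∀ᶠ y in 𝓝 x, CurvatureBound σ y C := by
  obtain ⟨c, hc, hcoer⟩ := eventually_coercive hσ.continuousAt hpos
  have h1 : ContDiffAt ℝ 1 (fderiv ℝ σ) x := hσ.fderiv_right (by norm_num)
  have h2 : ContDiffAt ℝ 0 (fderiv ℝ (fderiv ℝ σ)) x := h1.fderiv_right (by norm_num)
  set B := max (‖fderiv ℝ σ x‖) (‖fderiv ℝ (fderiv ℝ σ) x‖) + 1 with hB
  have hB0 : 0 ≤ B := by positivity
  refine ⟨(2 * B + 9 / 4 * B ^ 2 / c) / c ^ 2, by positivity, ?_⟩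
  have e1 : ∀ᶠ y in 𝓝 x, ‖fderiv ℝ σ y‖ < B :=
    h1.continuousAt.norm.eventually (gt_mem_nhds (by
      have := le_max_left (‖fderiv ℝ σ x‖) (‖fderiv ℝ (fderiv ℝ σ) x‖); linarith))
  have e2 : ∀ᶠ y in 𝓝 x, ‖fderiv ℝ (fderiv ℝ σ) y‖ < B :=
    h2.continuousAt.norm.eventually (gt_mem_nhds (by
      have := le_max_right (‖fderiv ℝ σ x‖) (‖fderiv ℝ (fderiv ℝ σ) x‖); linarith))
  filter_upwards [e1, e2, hcoer] with y hy1 hy2 hy3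
  exact curvatureBound_of_norm_le hB0 hc hy1.le hy2.le hy3

end LocalBounds

/-! ### The metric of `M` in a chart -/

section Chart

variable {n : ℕ} {M : Type*} [TopologicalSpace M] [ChartedSpace (EuclideanSpace ℝ (Fin n)) M]

theorem mfderiv_symm_bijective
    {e : OpenPartialHomeomorph M (EuclideanSpace ℝ (Fin n))} (he : e ∈ IsManifold.maximalAtlas (𝓡 n) ∞ M)
    {x : EuclideanSpace ℝ (Fin n)} (hx : x ∈ e.target) :
    Function.Bijective (mfderiv (𝓡 n) (𝓡 n) e.symm x) := by
  have : e.MDifferentiable (𝓡 n) (𝓡 n) :=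
    ⟨(contMDiffOn_of_mem_maximalAtlas he).mdifferentiableOn (by simp),
      (contMDiffOn_symm_of_mem_maximalAtlas he).mdifferentiableOn (by simp)⟩
  exact this.symm.mfderiv_bijective hx

variable [IsManifold (𝓡 n) ∞ M]

theorem chartMetric_add_left (g : Metric n M)
    (e : OpenPartialHomeomorph M (EuclideanSpace ℝ (Fin n))) (x a a' b : EuclideanSpace ℝ (Fin n)) :
    chartMetric g e x (a + a') b = chartMetric g e x a b + chartMetric g e x a' b := by
  have h : mfderiv (𝓡 n) (𝓡 n) e.symm x (a + a') = mfderiv (𝓡 n) (𝓡 n) e.symm x a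
    + mfderiv (𝓡 n) (𝓡 n) e.symm x a' := map_add (mfderiv (𝓡 n) (𝓡 n) e.symm x) a a'
  simp only [chartMetric]
  rw [h, map_add, add_apply]

theorem chartMetric_smul_left (g : Metric n M)
    (e : OpenPartialHomeomorph M (EuclideanSpace ℝ (Fin n))) (c : ℝ)
    (x a b : EuclideanSpace ℝ (Fin n)) :
    chartMetric g e x (c • a) b = c * chartMetric g e x a b := by
  have h : mfderiv (𝓡 n) (𝓡 n) e.symm x (c • a) = c • mfderiv (𝓡 n) (𝓡 n) e.symm x a :=
    map_smul (mfderiv (𝓡 n) (𝓡 n) e.symm x) c a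
  simp only [chartMetric]
  rw [h, map_smul, smul_apply, smul_eq_mul]

theorem chartMetric_symm (g : Metric n M)
    (e : OpenPartialHomeomorph M (EuclideanSpace ℝ (Fin n))) (x a b : EuclideanSpace ℝ (Fin n)) :
    chartMetric g e x a b = chartMetric g e x b a := g.symm _ _ _

/-- `chartMetric` as a bounded bilinear form. -/
def chartForm (g : Metric n M) (e : OpenPartialHomeomorph M (EuclideanSpace ℝ (Fin n)))
    (x : EuclideanSpace ℝ (Fin n)) :
    EuclideanSpace ℝ (Fin n) →L[ℝ] EuclideanSpace ℝ (Fin n) →L[ℝ] ℝ :=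
  LinearMap.toContinuousLinearMap (LinearMap.toContinuousLinearMap.toLinearMap ∘ₗ
    LinearMap.mk₂ ℝ (chartMetric g e x)
      (fun a a' b => chartMetric_add_left g e x a a' b)
      (fun c a b => chartMetric_smul_left g e c x a b)
      (fun a b b' => by
        rw [chartMetric_symm, chartMetric_add_left, chartMetric_symm g e x b,
          chartMetric_symm g e x b'])
      (fun c a b => by
        rw [chartMetric_symm, chartMetric_smul_left, chartMetric_symm, smul_eq_mul]))

variable (g : Metric n M) {e : OpenPartialHomeomorph M (EuclideanSpace ℝ (Fin n))}

@[simp] theorem chartForm_apply (x a b : EuclideanSpace ℝ (Fin n)) :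
    chartForm g e x a b = chartMetric g e x a b := rfl

theorem chartForm_symm (x a b : EuclideanSpace ℝ (Fin n)) :
    chartForm g e x a b = chartForm g e x b a := g.symm _ _ _

/-- Each component is the bundle metric applied to two coordinate fields, which are smooth as images
of constant fields under the tangent map of `e.symm`. -/
theorem contDiffOn_chartForm (he : e ∈ IsManifold.maximalAtlas (𝓡 n) ∞ M) :
    ContDiffOn ℝ 2 (chartForm g e) e.target := by
  rw [contDiffOn_clm_apply]
  intro a
  rw [contDiffOn_clm_apply]
  intro b
  have hsymm : ContMDiffOn (𝓡 n) (𝓡 n) ∞ e.symm e.target :=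
    contMDiffOn_symm_of_mem_maximalAtlas he
  have hvec : ∀ a : EuclideanSpace ℝ (Fin n), ContMDiffOn (𝓡 n) (𝓡 n).tangent 2
      (fun x => (Bundle.TotalSpace.mk' (EuclideanSpace ℝ (Fin n)) (e.symm x)
        (mfderiv (𝓡 n) (𝓡 n) e.symm x a) : TangentBundle (𝓡 n) M)) e.target := by
    intro a
    have h1 := hsymm.contMDiffOn_tangentMapWithin (m := 2) (by norm_cast)
      e.open_target.uniqueMDiffOn
    have h2 : ContMDiffOn (𝓡 n) (𝓡 n).tangent 2 (fun x : EuclideanSpace ℝ (Fin n) =>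
        (⟨x, a⟩ : TangentBundle (𝓡 n) (EuclideanSpace ℝ (Fin n)))) e.target :=
      (contMDiff_vectorSpace_iff_contDiff.2 contDiff_const).contMDiffOn
    have h3 := h1.comp h2 (fun x hx => hx)
    refine h3.congr fun x hx => ?_
    simp only [Function.comp, tangentMapWithin]
    rw [mfderivWithin_of_isOpen e.open_target hx]
  have hg : ContMDiffOn (𝓡 n) ((𝓡 n).prod 𝓘(ℝ, EuclideanSpace ℝ (Fin n) →L[ℝ]
      EuclideanSpace ℝ (Fin n) →L[ℝ] ℝ)) 2 (fun x => Bundle.TotalSpace.mk' (EuclideanSpace ℝ (Fin n) →L[ℝ]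
      EuclideanSpace ℝ (Fin n) →L[ℝ] ℝ) (E := fun y : M => TangentSpace (𝓡 n) y →L[ℝ]
        TangentSpace (𝓡 n) y →L[ℝ] ℝ) (e.symm x) (g.inner (e.symm x))) e.target :=
    (g.contMDiff.of_le (by norm_cast)).comp_contMDiffOn (hsymm.of_le (by norm_cast))
  have h : ContMDiffOn (𝓡 n) ((𝓡 n).prod 𝓘(ℝ)) 2 (fun x => Bundle.TotalSpace.mk' ℝ
      (E := Bundle.Trivial M ℝ) (e.symm x) (g.inner (e.symm x)
        (mfderiv (𝓡 n) (𝓡 n) e.symm x a) (mfderiv (𝓡 n) (𝓡 n) e.symm x b))) e.target := by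
    apply ContMDiffOn.clm_bundle_apply₂ (F₁ := EuclideanSpace ℝ (Fin n))
      (F₂ := EuclideanSpace ℝ (Fin n))
    · exact hg
    · exact hvec a
    · exact hvec b
  intro x hx
  have hx' := h x hx
  rw [Bundle.contMDiffWithinAt_totalSpace] at hx'
  exact hx'.2.contDiffWithinAt

theorem chartForm_pos (he : e ∈ IsManifold.maximalAtlas (𝓡 n) ∞ M)
    {x : EuclideanSpace ℝ (Fin n)} (hx : x ∈ e.target)
    (a : EuclideanSpace ℝ (Fin n)) (ha : a ≠ 0) : 0 < chartForm g e x a a := by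
  refine g.pos _ _ fun h0 => ha ?_
  exact (mfderiv_symm_bijective he hx).1 (h0.trans (map_zero _).symm)

end Chart

/-! ### The gradient field of a metric, in coordinates and on `M` -/

section Gradient

variable {E : Type*} [NormedAddCommGroup E] [NormedSpace ℝ E] [FiniteDimensional ℝ E]

theorem isInvertible_of_pos {B : E →L[ℝ] E →L[ℝ] ℝ} (hpos : ∀ a, a ≠ 0 → 0 < B a a) :
    B.IsInvertible := by
  have hinj : Function.Injective (B : E →ₗ[ℝ] E →L[ℝ] ℝ) := by
    rw [injective_iff_map_eq_zero]
    intro a ha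
    by_contra hne
    have h1 := hpos a hne
    have h2 : B a = 0 := ha
    simp [h2] at h1
  have hfin : Module.finrank ℝ E = Module.finrank ℝ (E →L[ℝ] ℝ) := by
    rw [← (LinearMap.toContinuousLinearMap : (E →ₗ[ℝ] ℝ) ≃ₗ[ℝ] (E →L[ℝ] ℝ)).finrank_eq]
    exact (Subspace.dual_finrank_eq (K := ℝ) (V := E)).symm
  refine ⟨(LinearEquiv.ofInjectiveOfFinrankEq (B : E →ₗ[ℝ] E →L[ℝ] ℝ) hinj
    hfin).toContinuousLinearEquiv, ?_⟩
  ext a b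
  rfl

/-- The gradient of `v` with respect to the metric `σ`. -/
def gradField (σ : E → E →L[ℝ] E →L[ℝ] ℝ) (v : E → ℝ) (x : E) : E :=
  (σ x).inverse (fderiv ℝ v x)

theorem apply_gradField {σ : E → E →L[ℝ] E →L[ℝ] ℝ} {v : E → ℝ} {x : E}
    (hpos : ∀ a, a ≠ 0 → 0 < σ x a a) : σ x (gradField σ v x) = fderiv ℝ v x := by
  obtain ⟨T, hT⟩ := isInvertible_of_pos hpos
  rw [gradField, ← hT, ContinuousLinearMap.inverse_equiv]
  simp

/-- Inversion of linear maps is smooth at invertible ones, so the gradient is as regular as the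
worse of `σ` and `dv`. -/
theorem isLocalGradient_gradField {σ : E → E →L[ℝ] E →L[ℝ] ℝ} {v : E → ℝ} {x : E}
    (hσ : ContDiffAt ℝ 2 σ x) (hsymm : ∀ᶠ y in 𝓝 x, ∀ a b, σ y a b = σ y b a)
    (hpos : ∀ᶠ y in 𝓝 x, ∀ a, a ≠ 0 → 0 < σ y a a) (hv : ContDiffAt ℝ 3 v x) :
    IsLocalGradient σ v (gradField σ v) x where
  metric := hσ
  symm := hsymm
  fn := hv
  grad := by
    have h1 : ContDiffAt ℝ 2 (ContinuousLinearMap.inverse : (E →L[ℝ] E →L[ℝ] ℝ) → _) (σ x) :=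
      (isInvertible_of_pos hpos.self_of_nhds).contDiffAt_map_inverse
    exact (h1.comp x hσ).clm_apply hv.fderiv_three
  eq := hpos.mono fun y hy => apply_gradField hy

end Gradient

section ChartGradient

variable {n : ℕ} {M : Type*} [TopologicalSpace M] [ChartedSpace (EuclideanSpace ℝ (Fin n)) M]
  {e : OpenPartialHomeomorph M (EuclideanSpace ℝ (Fin n))}
  {z : M → ℝ}

theorem contDiffOn_chart (he : e ∈ IsManifold.maximalAtlas (𝓡 n) ∞ M)
    (hz : ContMDiff (𝓡 n) 𝓘(ℝ, ℝ) 3 z) : ContDiffOn ℝ 3 (fun x => z (e.symm x)) e.target := by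
  have h1 : ContMDiffOn (𝓡 n) (𝓡 n) 3 e.symm e.target :=
    (contMDiffOn_symm_of_mem_maximalAtlas he).of_le (by norm_cast)
  exact (hz.comp_contMDiffOn h1).contDiffOn

theorem fderiv_chart (he : e ∈ IsManifold.maximalAtlas (𝓡 n) ∞ M)
    (hz : ContMDiff (𝓡 n) 𝓘(ℝ, ℝ) 3 z) {x : EuclideanSpace ℝ (Fin n)} (hx : x ∈ e.target)
    (y : EuclideanSpace ℝ (Fin n)) :
    fderiv ℝ (fun x => z (e.symm x)) x y
      = mfderiv (𝓡 n) 𝓘(ℝ, ℝ) z (e.symm x) (mfderiv (𝓡 n) (𝓡 n) e.symm x y) := by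
  have h1 : MDifferentiableAt (𝓡 n) (𝓡 n) e.symm x :=
    ((contMDiffOn_symm_of_mem_maximalAtlas he).mdifferentiableOn (by simp) x hx).mdifferentiableAt
      (e.open_target.mem_nhds hx)
  have h2 := mfderiv_comp x (hz.mdifferentiable (by simp) (e.symm x)) h1
  rw [← mfderiv_eq_fderiv]
  change mfderiv (𝓡 n) 𝓘(ℝ, ℝ) (z ∘ e.symm) x y = _
  rw [h2]
  rfl

variable [IsManifold (𝓡 n) ∞ M] (g : Metric n M)

theorem inner_gradient (u : M) (y : TangentSpace (𝓡 n) u) :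
    g.inner u (gradient g z u) y = mfderiv (𝓡 n) 𝓘(ℝ, ℝ) z u y := by
  have : FiniteDimensional ℝ (TangentSpace (𝓡 n) u) :=
    inferInstanceAs (FiniteDimensional ℝ (EuclideanSpace ℝ (Fin n)))
  exact LinearMap.BilinForm.apply_toDual_symm_apply (B := metricForm g u)
    (hB := metricForm_nondegenerate g u)
    (mfderiv (𝓡 n) 𝓘(ℝ, ℝ) z u).toLinearMap y

/-- The push-forward of the coordinate gradient and the intrinsic gradient represent the same
differential, so definiteness of `g` makes them equal. -/
theorem gradientNorm_chart (he : e ∈ IsManifold.maximalAtlas (𝓡 n) ∞ M)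
    (hz : ContMDiff (𝓡 n) 𝓘(ℝ, ℝ) 3 z) {x : EuclideanSpace ℝ (Fin n)} (hx : x ∈ e.target) :
    gradientNorm g z (e.symm x) = √(fderiv ℝ (fun x => z (e.symm x)) x
      (gradField (chartForm g e) (fun x => z (e.symm x)) x)) := by
  set W := gradField (chartForm g e) (fun x => z (e.symm x)) x with hW
  have h1 : chartForm g e x W = fderiv ℝ (fun x => z (e.symm x)) x :=
    apply_gradField (chartForm_pos g he hx)
  have h2 : ∀ y, g.inner (e.symm x) (mfderiv (𝓡 n) (𝓡 n) e.symm x W) y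
      = g.inner (e.symm x) (gradient g z (e.symm x)) y := by
    intro y
    obtain ⟨y', rfl⟩ := (mfderiv_symm_bijective he hx).2 y
    exact (congrArg (fun T : EuclideanSpace ℝ (Fin n) →L[ℝ] ℝ => T y') h1).trans
      ((fderiv_chart he hz hx y').trans (inner_gradient g _ _).symm)
  have h3 : mfderiv (𝓡 n) (𝓡 n) e.symm x W = gradient g z (e.symm x) := by
    generalize mfderiv (𝓡 n) (𝓡 n) e.symm x W = V at h2
    by_contra hne
    have h4 := g.pos _ _ (sub_ne_zero.2 hne)
    have h5 : g.inner (e.symm x) V = g.inner (e.symm x) (gradient g z (e.symm x)) :=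
      ContinuousLinearMap.ext h2
    have h6 : g.inner (e.symm x) (V - gradient g z (e.symm x)) = 0 := by
      rw [map_sub, h5, sub_self]
    rw [h6] at h4
    exact lt_irrefl _ h4
  rw [gradientNorm, ← h3, ← h1]
  rfl

theorem continuous_gradientNorm (hz : ContMDiff (𝓡 n) 𝓘(ℝ, ℝ) 3 z) :
    Continuous (gradientNorm g z) := by
  rw [continuous_iff_continuousAt]
  intro u
  have he := IsManifold.chart_mem_maximalAtlas (I := 𝓡 n) (n := ∞) u
  set e := chartAt (EuclideanSpace ℝ (Fin n)) u
  have hu : u ∈ e.source := mem_chart_source _ u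
  have hx : e u ∈ e.target := e.map_source hu
  have hlg : IsLocalGradient (chartForm g e) (fun x => z (e.symm x))
      (gradField (chartForm g e) (fun x => z (e.symm x))) (e u) := by
    refine isLocalGradient_gradField ((contDiffOn_chartForm g he).contDiffAt
      (e.open_target.mem_nhds hx)) (Eventually.of_forall fun y => chartForm_symm g y) ?_
      ((contDiffOn_chart he hz).contDiffAt (e.open_target.mem_nhds hx))
    filter_upwards [e.open_target.mem_nhds hx] with y hy using chartForm_pos g he hy
  have hc : ContinuousAt (fun x => √(fderiv ℝ (fun x => z (e.symm x)) x
      (gradField (chartForm g e) (fun x => z (e.symm x)) x))) (e u) :=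
    (hlg.fn.fderiv_three.continuousAt.clm_apply hlg.grad.continuousAt).sqrt
  refine (ContinuousAt.comp hc (e.continuousAt hu)).congr ?_
  filter_upwards [e.open_source.mem_nhds hu] with y hy
  have := gradientNorm_chart g he hz (e.map_source hy)
  rw [e.left_inv hy] at this
  exact this.symm

end ChartGradient

/-! ### The second fundamental form of a graph -/

section SecondFundamentalForm

/-- The Hessian of `r ∘ Z` when `r' = 1 / h`. -/
theorem fderiv_comp_inv {E : Type*} [NormedAddCommGroup E] [NormedSpace ℝ E] {Z : E → ℝ} {x : E}
    (hZ : ContDiffAt ℝ 3 Z x) {r h : ℝ → ℝ} (hr : ∀ᶠ t in 𝓝 (Z x), HasDerivAt r (h t)⁻¹ t)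
    (a : E) : fderiv ℝ (fun y => r (Z y)) x a = (h (Z x))⁻¹ * fderiv ℝ Z x a := by
  have h1 := hr.self_of_nhds.comp_hasFDerivAt x (hZ.differentiableAt (by simp)).hasFDerivAt
  have h2 : fderiv ℝ (fun y => r (Z y)) x = (h (Z x))⁻¹ • fderiv ℝ Z x := h1.fderiv
  rw [h2, smul_apply, smul_eq_mul]

/-- Product rule for `(1 / h(Z)) dZ`; the second term comes from differentiating `1 / h(Z)`. -/
theorem hessian_comp_inv {E : Type*} [NormedAddCommGroup E] [NormedSpace ℝ E] {Z : E → ℝ} {x : E}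
    (hZ : ContDiffAt ℝ 3 Z x) {r h : ℝ → ℝ} {h' : ℝ}
    (hr : ∀ᶠ t in 𝓝 (Z x), HasDerivAt r (h t)⁻¹ t) (hpos : 0 < h (Z x))
    (hh : HasDerivAt h h' (Z x)) (a b : E) :
    fderiv ℝ (fderiv ℝ fun y => r (Z y)) x a b
      = (h (Z x))⁻¹ * fderiv ℝ (fderiv ℝ Z) x a b
        - h' / h (Z x) ^ 2 * fderiv ℝ Z x a * fderiv ℝ Z x b := by
  have hev : fderiv ℝ (fun y => r (Z y)) =ᶠ[𝓝 x] fun y => (h (Z y))⁻¹ • fderiv ℝ Z y := by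
    filter_upwards [hZ.eventually (by simp), hZ.continuousAt.eventually hr.eventually_nhds]
      with y hy1 hy2
    ext a
    rw [fderiv_comp_inv hy1 hy2, smul_apply, smul_eq_mul]
  have hd := hZ.differentiableAt (by simp)
  have h1 : HasDerivAt (fun s : ℝ => h (Z (x + s • a))) (h' * fderiv ℝ Z x a) 0 :=
    HasDerivAt.comp (h₂ := h) (0 : ℝ) (by simpa using hh) (hasDerivAt_line_zero x a hd)
  have hd2 : DifferentiableAt ℝ (fderiv ℝ fun y => r (Z y)) x := by
    refine DifferentiableAt.congr_of_eventuallyEq ?_ hev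
    exact ((hh.differentiableAt.comp x hd).inv hpos.ne').smul
      (hZ.fderiv_three.differentiableAt (by simp))
  have h2 := (hasDerivAt_line_zero x a hd2).clm_apply (hasDerivAt_const (0 : ℝ) b)
  have h3 := ((h1.fun_inv (by simpa using hpos.ne')).mul ((hasDerivAt_line_zero x a
    (hZ.fderiv_three.differentiableAt (by simp))).clm_apply (hasDerivAt_const (0 : ℝ) b)))
  have h4 := h3.congr_of_eventuallyEq (((tendsto_line x a).eventually hev).mono fun s hs =>
    congrArg (fun T : E →L[ℝ] ℝ => T b) hs)
  have h5 := h2.unique h4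
  simp only [map_zero, add_zero, zero_smul] at h5
  rw [h5]
  field_simp
  ring

variable {n : ℕ} {M : Type*} [TopologicalSpace M]
  {e : OpenPartialHomeomorph M (EuclideanSpace ℝ (Fin n))}
  {z : M → ℝ} {x : EuclideanSpace ℝ (Fin n)} {h : ℝ → ℝ} {h' : ℝ}

theorem fderiv_graphMap (hZ : DifferentiableAt ℝ (fun y => z (e.symm y)) x)
    (a : EuclideanSpace ℝ (Fin n)) :
    fderiv ℝ (graphMap z e) x a = (fderiv ℝ (fun y => z (e.symm y)) x a, a) := by
  have h1 : HasFDerivAt (graphMap z e) ((fderiv ℝ (fun y => z (e.symm y)) x).prod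
      (ContinuousLinearMap.id ℝ _)) x := hZ.hasFDerivAt.prodMk (hasFDerivAt_id x)
  rw [h1.fderiv]
  rfl

theorem fderiv_fderiv_graphMap (hZ : ContDiffAt ℝ 3 (fun y => z (e.symm y)) x)
    (a b : EuclideanSpace ℝ (Fin n)) :
    fderiv ℝ (fun y => fderiv ℝ (graphMap z e) y b) x a
      = (fderiv ℝ (fderiv ℝ fun y => z (e.symm y)) x a b, 0) := by
  have hev : (fun y => fderiv ℝ (graphMap z e) y b)
      =ᶠ[𝓝 x] fun y => (fderiv ℝ (fun y => z (e.symm y)) y b, b) := by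
    filter_upwards [hZ.eventually (by simp)] with y hy
    exact fderiv_graphMap (hy.differentiableAt (by simp)) b
  have h1 : HasFDerivAt (fun y => (fderiv ℝ (fun y => z (e.symm y)) y b, b)) _ x :=
    ((hZ.fderiv_three.differentiableAt (by simp)).hasFDerivAt.clm_apply
      (hasFDerivAt_const b x)).prodMk (hasFDerivAt_const b x)
  rw [hev.fderiv_eq, h1.fderiv]
  simp

variable [ChartedSpace (EuclideanSpace ℝ (Fin n)) M] [IsManifold (𝓡 n) ∞ M] (g : Metric n M)

theorem fderiv_warpedMetric {t : ℝ} (hσ : DifferentiableAt ℝ (chartForm g e) x)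
    (hh : HasDerivAt h h' t) (a b c : ℝ × EuclideanSpace ℝ (Fin n)) :
    fderiv ℝ (fun q => warpedMetric g h e q b c) (t, x) a
      = 2 * h t * h' * a.1 * chartForm g e x b.2 c.2
        + h t ^ 2 * fderiv ℝ (chartForm g e) x a.2 b.2 c.2 := by
  have h1 : HasFDerivAt (fun q : ℝ × EuclideanSpace ℝ (Fin n) => h q.1) _ (t, x) :=
    hh.comp_hasFDerivAt (t, x) (hasFDerivAt_fst (𝕜 := ℝ) (p := (t, x)))
  have h2 : HasFDerivAt (fun q : ℝ × EuclideanSpace ℝ (Fin n) => chartForm g e q.2)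
      ((fderiv ℝ (chartForm g e) x).comp (ContinuousLinearMap.snd ℝ ℝ _)) (t, x) :=
    HasFDerivAt.comp (g := chartForm g e) (t, x) hσ.hasFDerivAt hasFDerivAt_snd
  have h3 : HasFDerivAt (fun q => warpedMetric g h e q b c) _ (t, x) :=
    ((h1.pow 2).mul ((h2.clm_apply (hasFDerivAt_const b.2 _)).clm_apply
      (hasFDerivAt_const c.2 _))).const_add (b.1 * c.1)
  rw [h3.fderiv]
  simp
  ring

end SecondFundamentalForm

/-! ### Principal curvatures through the Hessian of `r ∘ z` -/

section PrincipalCurvatures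

variable {n : ℕ} {M : Type*} [TopologicalSpace M]
  {e : OpenPartialHomeomorph M (EuclideanSpace ℝ (Fin n))}
  {z : M → ℝ} {x : EuclideanSpace ℝ (Fin n)} {h : ℝ → ℝ} {h' : ℝ}
  [ChartedSpace (EuclideanSpace ℝ (Fin n)) M] [IsManifold (𝓡 n) ∞ M] (g : Metric n M)

theorem gradField_comp_inv {Z : EuclideanSpace ℝ (Fin n) → ℝ} (hZ : ContDiffAt ℝ 3 Z x)
    (σ : EuclideanSpace ℝ (Fin n) → EuclideanSpace ℝ (Fin n) →L[ℝ] EuclideanSpace ℝ (Fin n) →L[ℝ] ℝ)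
    {r : ℝ → ℝ} (hr : ∀ᶠ t in 𝓝 (Z x), HasDerivAt r (h t)⁻¹ t) :
    gradField σ (fun y => r (Z y)) x = (h (Z x))⁻¹ • gradField σ Z x := by
  have : fderiv ℝ (fun y => r (Z y)) x = (h (Z x))⁻¹ • fderiv ℝ Z x := by
    ext a
    rw [fderiv_comp_inv hZ hr, smul_apply, smul_eq_mul]
  rw [gradField, gradField, this, map_smul]

/-- The components of the inward unit normal. -/
theorem IsInwardNormal.eq {N : ℝ × EuclideanSpace ℝ (Fin n)}
    (hZ : DifferentiableAt ℝ (fun y => z (e.symm y)) x) (hpos : 0 < h (z (e.symm x)))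
    (hσ : ∀ a, a ≠ 0 → 0 < chartForm g e x a a) (hN : IsInwardNormal g h z e x N) :
    N.2 = -(N.1 / h (z (e.symm x)) ^ 2) • gradField (chartForm g e) (fun y => z (e.symm y)) x ∧
      N.1 = -(√(1 + fderiv ℝ (fun y => z (e.symm y)) x
        (gradField (chartForm g e) (fun y => z (e.symm y)) x) / h (z (e.symm x)) ^ 2))⁻¹ := by
  set H := h (z (e.symm x)) with hH
  set P := fderiv ℝ (fun y => z (e.symm y)) x with hP
  set W := gradField (chartForm g e) (fun y => z (e.symm y)) x with hW
  have hWP : chartForm g e x W = P := apply_gradField hσ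
  have hn : ∀ a, N.1 * P a + H ^ 2 * chartForm g e x N.2 a = 0 := by
    intro a
    have := hN.normal a
    rw [fderiv_graphMap hZ] at this
    exact this
  have h2 : N.2 = -(N.1 / H ^ 2) • W := by
    by_contra hne
    have h3 := hσ _ (sub_ne_zero.2 hne)
    have h4 : ∀ a, chartForm g e x (N.2 - -(N.1 / H ^ 2) • W) a = 0 := by
      intro a
      rw [map_sub, map_smul, hWP, sub_apply, smul_apply, smul_eq_mul]
      have := hn a
      field_simp
      linarith
    rw [h4] at h3
    exact lt_irrefl _ h3
  refine ⟨h2, ?_⟩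
  have hunit : N.1 * N.1 + H ^ 2 * chartForm g e x N.2 N.2 = 1 := hN.unit
  have hin : N.1 * 1 + H ^ 2 * chartForm g e x N.2 0 < 0 := hN.inward
  rw [map_zero, mul_zero, add_zero, mul_one] at hin
  have hWW : 0 ≤ P W := by
    rw [← hWP]
    rcases eq_or_ne W 0 with h0 | h0
    · simp [h0]
    · exact (hσ W h0).le
  have h5 : N.1 ^ 2 * (1 + P W / H ^ 2) = 1 := by
    rw [h2] at hunit
    simp only [map_smul, smul_apply, smul_eq_mul, hWP] at hunit
    refine Eq.trans ?_ hunit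
    field_simp
  have hQ : 0 < 1 + P W / H ^ 2 := by positivity
  have h6 : (-N.1 * √(1 + P W / H ^ 2)) ^ 2 = 1 := by
    rw [mul_pow, Real.sq_sqrt hQ.le, neg_sq, h5]
  -- The unit condition leaves two signs; `N.1 < 0`, the inward condition, selects this one.
  have h7 : -N.1 * √(1 + P W / H ^ 2) = 1 := by
    have h8 : 0 < -N.1 * √(1 + P W / H ^ 2) := mul_pos (by linarith) (Real.sqrt_pos.2 hQ)
    nlinarith
  have h9 := (Real.sqrt_pos.2 hQ).ne'
  generalize √(1 + P W / H ^ 2) = S at h7 h9 ⊢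
  field_simp
  linarith

/-- The second fundamental form of the graph in terms of the covariant Hessian of `r ∘ z`. -/
theorem secondFundamentalForm_graph {N : ℝ × EuclideanSpace ℝ (Fin n)}
    (hZ : ContDiffAt ℝ 3 (fun y => z (e.symm y)) x) (hpos : 0 < h (z (e.symm x)))
    (hh : HasDerivAt h h' (z (e.symm x))) (hσd : DifferentiableAt ℝ (chartForm g e) x)
    (hσ : ∀ a, a ≠ 0 → 0 < chartForm g e x a a)
    {r : ℝ → ℝ} (hr : ∀ᶠ t in 𝓝 (z (e.symm x)), HasDerivAt r (h t)⁻¹ t)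
    (hN : IsInwardNormal g h z e x N) (a b : EuclideanSpace ℝ (Fin n)) :
    secondFundamentalForm (warpedMetric g h e) (graphMap z e) x N a b
      = N.1 * h (z (e.symm x)) *
        (covHess (chartForm g e) (fun y => r (z (e.symm y)))
          (gradField (chartForm g e) fun y => r (z (e.symm y))) x a b
          - h' * graphForm (chartForm g e) (fun y => r (z (e.symm y))) x a b) := by
  have hZd := hZ.differentiableAt (by simp)
  obtain ⟨h2, -⟩ := hN.eq g hZd hpos hσ
  rw [secondFundamentalForm, fderiv_fderiv_graphMap hZ, fderiv_graphMap hZd, fderiv_graphMap hZd,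
    covHess, graphForm, gradField_comp_inv (h := h) hZ _ hr, hessian_comp_inv hZ hr hpos hh,
    fderiv_comp_inv hZ hr, fderiv_comp_inv hZ hr]
  simp only [christoffel, graphMap]
  rw [fderiv_warpedMetric g hσd hh, fderiv_warpedMetric g hσd hh, fderiv_warpedMetric g hσd hh]
  simp only [warpedMetric, ← chartForm_apply]
  have hWP : ∀ a, chartForm g e x (gradField (chartForm g e) (fun y => z (e.symm y)) x) a
      = fderiv ℝ (fun y => z (e.symm y)) x a := fun a => by rw [apply_gradField hσ]
  rw [h2]
  set H := h (z (e.symm x))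
  set P := fderiv ℝ (fun y => z (e.symm y)) x
  set W := gradField (chartForm g e) (fun y => z (e.symm y)) x
  simp only [chris, map_smul, smul_apply, smul_eq_mul, chartForm_symm g x _ W, hWP, map_zero,
    zero_apply]
  field_simp
  ring

/-- The induced metric is `h²` times `graphForm`, so scaling the principal frame by `h` makes it
orthonormal for `graphForm`, and `secondFundamentalForm_graph` shows that it diagonalises the
covariant Hessian. -/
theorem localEquation_of_isPrincipalCurvatures {u : M} {l : Fin n → ℝ}
    {Γ : Set (Fin n → ℝ)} {f : (Fin n → ℝ) → ℝ} {rhs : ℝ} (hl : l ∈ Γ) (hfl : f l = rhs)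
    (he : e ∈ IsManifold.maximalAtlas (𝓡 n) ∞ M) (hu : u ∈ e.source)
    (hz : ContMDiff (𝓡 n) 𝓘(ℝ, ℝ) 3 z) (hpos : 0 < h (z u)) (hh : HasDerivAt h h' (z u))
    {r : ℝ → ℝ} (hr : ∀ᶠ t in 𝓝 (z u), HasDerivAt r (h t)⁻¹ t)
    (hpc : IsPrincipalCurvatures g h z u l) :
    LocalEquation Γ f (chartForm g e) (fun y => r (z (e.symm y)))
      (gradField (chartForm g e) fun y => r (z (e.symm y))) (h (z u)) h' rhs (e u) := by
  obtain ⟨N, b, hN, hb, hs⟩ := hpc e he hu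
  have hx : e u ∈ e.target := e.map_source hu
  have hZ : ContDiffAt ℝ 3 (fun y => z (e.symm y)) (e u) :=
    (contDiffOn_chart he hz).contDiffAt (e.open_target.mem_nhds hx)
  have hσd : DifferentiableAt ℝ (chartForm g e) (e u) :=
    ((contDiffOn_chartForm g he).contDiffAt (e.open_target.mem_nhds hx)).differentiableAt (by simp)
  have hσ := chartForm_pos g he hx
  have hzu : z (e.symm (e u)) = z u := by rw [e.left_inv hu]
  rw [← hzu] at hpos hh hr ⊢
  have hZd := hZ.differentiableAt (by simp)
  obtain ⟨-, hN1⟩ := hN.eq g hZd hpos hσ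
  set H := h (z (e.symm (e u))) with hH
  have hform : ∀ a b, inducedMetric (warpedMetric g h e) (graphMap z e) (e u) a b
      = H ^ 2 * graphForm (chartForm g e) (fun y => r (z (e.symm y))) (e u) a b := by
    intro a b
    rw [inducedMetric, fderiv_graphMap hZd, fderiv_graphMap hZd, graphForm, fderiv_comp_inv hZ hr,
      fderiv_comp_inv hZ hr, warpedMetric]
    simp only [graphMap, ← chartForm_apply, ← hH]
    field_simp
    ring
  have hQ : 1 + fderiv ℝ (fun y => r (z (e.symm y))) (e u)
      (gradField (chartForm g e) (fun y => r (z (e.symm y))) (e u))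
      = 1 + fderiv ℝ (fun y => z (e.symm y)) (e u)
        (gradField (chartForm g e) (fun y => z (e.symm y)) (e u)) / H ^ 2 := by
    rw [fderiv_comp_inv hZ hr, gradField_comp_inv (h := h) hZ _ hr, map_smul, smul_eq_mul, ← hH]
    field_simp
  have hQpos : 0 < √(1 + fderiv ℝ (fun y => z (e.symm y)) (e u)
        (gradField (chartForm g e) (fun y => z (e.symm y)) (e u)) / H ^ 2) := by
    have hN1' : N.1 < 0 := by
      have hin : N.1 * 1 + H ^ 2 * chartForm g e (e u) N.2 0 < 0 := hN.inward
      rwa [map_zero, mul_zero, add_zero, mul_one] at hin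
    rw [hN1] at hN1'
    exact inv_pos.1 (by linarith)
  set S := √(1 + fderiv ℝ (fun y => z (e.symm y)) (e u)
    (gradField (chartForm g e) (fun y => z (e.symm y)) (e u)) / H ^ 2) with hS
  have hgr : ∀ i j, graphForm (chartForm g e) (fun y => r (z (e.symm y))) (e u) (b i) (b j)
      = (H ^ 2)⁻¹ * if i = j then 1 else 0 := by
    intro i j
    rw [← hb, hform]
    field_simp
  -- The value of `μ i` is obtained by solving `l i = (h' - μ i) / (H * S)`.
  refine ⟨l, hl, hfl, fun i => H • b i, fun i => h' - l i * (H * S),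
    fun i j => ?_, fun i j => ?_, fun i => ?_⟩
  · have h1 : graphForm (chartForm g e) (fun y => r (z (e.symm y))) (e u) (H • b i) (H • b j)
        = H ^ 2 * graphForm (chartForm g e) (fun y => r (z (e.symm y))) (e u) (b i) (b j) := by
      simp only [graphForm, map_smul, smul_apply, smul_eq_mul]
      ring
    rw [h1, hgr]
    field_simp
  · have h1 : covHess (chartForm g e) (fun y => r (z (e.symm y)))
        (gradField (chartForm g e) fun y => r (z (e.symm y))) (e u) (H • b i) (H • b j)
        = H ^ 2 * covHess (chartForm g e) (fun y => r (z (e.symm y)))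
        (gradField (chartForm g e) fun y => r (z (e.symm y))) (e u) (b i) (b j) := by
      simp only [covHess, chris, map_smul, smul_apply, smul_eq_mul]
      ring
    have h2 := hs i j
    rw [secondFundamentalForm_graph g hZ hpos hh hσd hσ hr hN, hgr, hN1, ← hH] at h2
    rw [h1]
    split_ifs at h2 ⊢ with hij
    · field_simp at h2 ⊢
      linarith
    · have h3 : N.1 ≠ 0 := by rw [hN1]; exact neg_ne_zero.2 (inv_ne_zero hQpos.ne')
      rw [hN1] at h3
      simpa [h3, hpos.ne', hQpos.ne'] using h2
  · rw [hQ, ← hS]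
    field_simp
    ring

end PrincipalCurvatures

/-! ### Comparison with the leaves -/

section Comparison

theorem _root_.IsLocalMax.fderiv_fderiv_nonpos {E : Type*} [NormedAddCommGroup E] [NormedSpace ℝ E]
    {v : E → ℝ} {x : E} (hmax : IsLocalMax v x) (hv : ContDiffAt ℝ 3 v x) (a : E) :
    fderiv ℝ (fderiv ℝ v) x a a ≤ 0 := by
  have h1 : IsLocalMax (fun s : ℝ => v (x + s • a)) 0 := by
    filter_upwards [(tendsto_line x a).eventually hmax] with s hs
    simpa using hs
  refine h1.second_deriv_nonpos (F' := fun s => fderiv ℝ v (x + s • a) a) ?_ ?_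
  · filter_upwards [(tendsto_line x a).eventually (hv.eventually (by simp))] with s hs
    exact hasDerivAt_line x a s (hs.differentiableAt (by simp))
  · have := (hasDerivAt_line_zero x a (hv.fderiv_three.differentiableAt (by simp))).clm_apply
      (hasDerivAt_const (0 : ℝ) a)
    simpa using this

theorem _root_.IsLocalMin.fderiv_fderiv_nonneg {E : Type*} [NormedAddCommGroup E] [NormedSpace ℝ E]
    {v : E → ℝ} {x : E} (hmin : IsLocalMin v x) (hv : ContDiffAt ℝ 3 v x) (a : E) :
    0 ≤ fderiv ℝ (fderiv ℝ v) x a a := by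
  have h1 := hmin.neg.fderiv_fderiv_nonpos hv.neg a
  have h2 : fderiv ℝ (fun y => -v y) = fun y => -fderiv ℝ v y := funext fun y => fderiv_fun_neg
  rw [h2, fderiv_fun_neg] at h1
  simpa using h1

variable {E : Type*} [NormedAddCommGroup E] [NormedSpace ℝ E]
  {σ : E → E →L[ℝ] E →L[ℝ] ℝ} {v : E → ℝ} {w : E → E} {x : E} {n : ℕ}
  {Γ : Set (Fin n → ℝ)} {f : (Fin n → ℝ) → ℝ} {h₀ h₁ rhs : ℝ}

/-- At a critical point `W = 1` and the covariant Hessian is the ordinary one, so every principal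
curvature is at most `h₁ / h₀`; `f` is monotone. -/
theorem LocalEquation.le_of_hessian_nonneg (hΓ : IsSymmetricCone Γ) (hf : IsCurvatureFunction Γ f)
    (H : LocalEquation Γ f σ v w h₀ h₁ rhs x) (hw : w x = 0) (hpos : 0 < h₀) (hκ : 0 < h₁ / h₀)
    (hess : ∀ a, 0 ≤ fderiv ℝ (fderiv ℝ v) x a a) : rhs ≤ f (fun _ => h₁ / h₀) := by
  obtain ⟨l, hl, rfl, c, μ, -, hμ, hlc⟩ := H
  refine hf.mono hΓ hl (hΓ.const_mem hκ) fun i => ?_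
  have h1 := hμ i i
  have h2 := hess (c i)
  simp only [covHess, chris, hw, map_zero, zero_apply, if_true, add_zero, sub_zero,
    zero_div] at h1
  rw [hlc, hw, map_zero, add_zero, Real.sqrt_one, mul_one]
  gcongr
  linarith

theorem LocalEquation.le_of_hessian_nonpos (hΓ : IsSymmetricCone Γ) (hf : IsCurvatureFunction Γ f)
    (H : LocalEquation Γ f σ v w h₀ h₁ rhs x) (hw : w x = 0) (hpos : 0 < h₀) (hκ : 0 < h₁ / h₀)
    (hess : ∀ a, fderiv ℝ (fderiv ℝ v) x a a ≤ 0) : f (fun _ => h₁ / h₀) ≤ rhs := by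
  obtain ⟨l, hl, rfl, c, μ, -, hμ, hlc⟩ := H
  refine hf.mono hΓ (hΓ.const_mem hκ) hl fun i => ?_
  have h1 := hμ i i
  have h2 := hess (c i)
  simp only [covHess, chris, hw, map_zero, zero_apply, if_true, add_zero, sub_zero,
    zero_div] at h1
  rw [hlc, hw, map_zero, add_zero, Real.sqrt_one, mul_one]
  gcongr
  linarith

end Comparison

/-- Supplies the coordinate `r` in which the warped metric becomes `h²` times a product metric. -/
theorem exists_primitive_inv {I : Set ℝ} (hI : IsOpen I) (hI' : I.OrdConnected) {h : ℝ → ℝ}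
    (hh : ContinuousOn h I) (hh_pos : ∀ t ∈ I, 0 < h t) {t₀ : ℝ} (ht₀ : t₀ ∈ I) :
    ∃ r : ℝ → ℝ, ∀ t ∈ I, HasDerivAt r (h t)⁻¹ t := by
  have hc : ContinuousOn (fun t => (h t)⁻¹) I := hh.inv₀ fun t ht => (hh_pos t ht).ne'
  refine ⟨fun t => ∫ τ in t₀..t, (h τ)⁻¹, fun t ht => ?_⟩
  refine intervalIntegral.integral_hasDerivAt_right ?_ ?_ (hc.continuousAt (hI.mem_nhds ht))
  · exact (hc.mono (hI'.uIcc_subset ht₀ ht)).intervalIntegrable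
  · exact hc.stronglyMeasurableAtFilter hI t ht

section Solution

variable {n : ℕ} {M : Type*} [TopologicalSpace M]
  [ChartedSpace (EuclideanSpace ℝ (Fin n)) M] [IsManifold (𝓡 n) ∞ M] {g : Metric n M}
  {I : Set ℝ} {h : ℝ → ℝ} {Γ : Set (Fin n → ℝ)} {f : (Fin n → ℝ) → ℝ} {rhs : ℝ → M → ℝ} {z : M → ℝ}
  {e : OpenPartialHomeomorph M (EuclideanSpace ℝ (Fin n))}

theorem IsSolution.localEquation (hz : IsSolution I g h Γ f rhs z) (hI : IsOpen I)
    (hh : ContDiffOn ℝ 2 h I) (hh_pos : ∀ t ∈ I, 0 < h t) {r : ℝ → ℝ}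
    (hr : ∀ t ∈ I, HasDerivAt r (h t)⁻¹ t) (he : e ∈ IsManifold.maximalAtlas (𝓡 n) ∞ M) {u : M}
    (hu : u ∈ e.source) :
    LocalEquation Γ f (chartForm g e) (fun y => r (z (e.symm y)))
      (gradField (chartForm g e) fun y => r (z (e.symm y))) (h (z u)) (deriv h (z u))
      (rhs (z u) u) (e u) := by
  obtain ⟨l, hl, hpc, hfl⟩ := hz.equation u
  have hzI := hz.mem u
  refine localEquation_of_isPrincipalCurvatures g hl hfl he hu hz.contMDiff (hh_pos _ hzI) ?_ ?_ hpc
  · exact ((hh.contDiffAt (hI.mem_nhds hzI)).differentiableAt (by simp)).hasDerivAt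
  · filter_upwards [hI.mem_nhds hzI] with t ht using hr t ht

/-- At a critical point of `z` the gradient of `r ∘ z` vanishes and its Hessian is a multiple of
that of `z`. -/
theorem IsSolution.comparison (hz : IsSolution I g h Γ f rhs z) (hI : IsOpen I)
    (hI' : I.OrdConnected)
    (hh : ContDiffOn ℝ 2 h I) (hh_pos : ∀ t ∈ I, 0 < h t) (hκ : ∀ t ∈ I, 0 < kappa h t)
    (hΓ : IsSymmetricCone Γ) (hf : IsCurvatureFunction Γ f) (u : M) :
    (IsLocalMin z u → rhs (z u) u ≤ leafValue f h (z u)) ∧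
      (IsLocalMax z u → leafValue f h (z u) ≤ rhs (z u) u) := by
  have he := IsManifold.chart_mem_maximalAtlas (I := 𝓡 n) (n := ∞) u
  set e := chartAt (EuclideanSpace ℝ (Fin n)) u
  have hu : u ∈ e.source := mem_chart_source _ u
  have hx : e u ∈ e.target := e.map_source hu
  have hzI := hz.mem u
  obtain ⟨r, hr⟩ := exists_primitive_inv hI hI' hh.continuousOn hh_pos hzI
  have heq := hz.localEquation hI hh hh_pos hr he hu
  have hZ : ContDiffAt ℝ 3 (fun y => z (e.symm y)) (e u) :=
    (contDiffOn_chart he hz.contMDiff).contDiffAt (e.open_target.mem_nhds hx)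
  have hzu : z (e.symm (e u)) = z u := by rw [e.left_inv hu]
  have hcont : Tendsto e.symm (𝓝 (e u)) (𝓝 u) := by
    have := e.symm.continuousAt hx
    rwa [ContinuousAt, e.left_inv hu] at this
  have hr' : ∀ᶠ t in 𝓝 (z (e.symm (e u))), HasDerivAt r (h t)⁻¹ t := by
    rw [hzu]
    filter_upwards [hI.mem_nhds hzI] with t ht using hr t ht
  have hh' : HasDerivAt h (deriv h (z u)) (z (e.symm (e u))) := by
    rw [hzu]
    exact ((hh.contDiffAt (hI.mem_nhds hzI)).differentiableAt (by simp)).hasDerivAt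
  have hposu := hh_pos _ hzI
  have hcrit : fderiv ℝ (fun y => z (e.symm y)) (e u) = 0 →
      gradField (chartForm g e) (fun y => r (z (e.symm y))) (e u) = 0 ∧
      ∀ a, fderiv ℝ (fderiv ℝ fun y => r (z (e.symm y))) (e u) a a
        = (h (z u))⁻¹ * fderiv ℝ (fderiv ℝ fun y => z (e.symm y)) (e u) a a := by
    intro h0
    constructor
    · rw [gradField_comp_inv (h := h) hZ _ hr', gradField, h0, map_zero, smul_zero]
    · intro a
      rw [hessian_comp_inv hZ hr' (by rw [hzu]; exact hposu) hh', h0, hzu]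
      simp
  have hκu : 0 < deriv h (z u) / h (z u) := hκ _ hzI
  constructor
  · intro hmin
    have hmin' : IsLocalMin (fun y => z (e.symm y)) (e u) := by
      filter_upwards [hcont.eventually hmin] with y hy
      simpa only [hzu] using hy
    obtain ⟨hw, hess⟩ := hcrit hmin'.fderiv_eq_zero
    refine heq.le_of_hessian_nonneg hΓ hf hw hposu hκu fun a => ?_
    rw [hess]
    exact mul_nonneg (inv_nonneg.2 hposu.le) (hmin'.fderiv_fderiv_nonneg hZ a)
  · intro hmax
    have hmax' : IsLocalMax (fun y => z (e.symm y)) (e u) := by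
      filter_upwards [hcont.eventually hmax] with y hy
      simpa only [hzu] using hy
    obtain ⟨hw, hess⟩ := hcrit hmax'.fderiv_eq_zero
    refine heq.le_of_hessian_nonpos hΓ hf hw hposu hκu fun a => ?_
    rw [hess]
    exact mul_nonpos_of_nonneg_of_nonpos (inv_nonneg.2 hposu.le) (hmax'.fderiv_fderiv_nonpos hZ a)

/-- The height of a solution lies between the barriers `tm` and `tp`. -/
theorem IsSolution.mem_Ioo [CompactSpace M] (hz : IsSolution I g h Γ f rhs z) (hI : IsOpen I)
    (hI' : I.OrdConnected)
    (hh : ContDiffOn ℝ 2 h I) (hh_pos : ∀ t ∈ I, 0 < h t) (hκ : ∀ t ∈ I, 0 < kappa h t)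
    (hΓ : IsSymmetricCone Γ) (hf : IsCurvatureFunction Γ f) {tm tp : ℝ}
    (ha : ∀ t ∈ I, t ≤ tm → ∀ u, leafValue f h t < rhs t u)
    (hb : ∀ t ∈ I, tp ≤ t → ∀ u, rhs t u < leafValue f h t) (u : M) : z u ∈ Ioo tm tp := by
  have hzc : Continuous z := hz.contMDiff.continuous
  have hne : (univ : Set M).Nonempty := ⟨u, mem_univ u⟩
  obtain ⟨a, -, hmin⟩ := isCompact_univ.exists_isMinOn hne hzc.continuousOn
  obtain ⟨b, -, hmax⟩ := isCompact_univ.exists_isMaxOn hne hzc.continuousOn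
  -- At the lowest and highest points the graph touches a leaf from one side. The resulting
  -- inequality between the right-hand side and `k` contradicts the barrier there unless the height
  -- is strictly inside.
  have h1 := (hz.comparison hI hI' hh hh_pos hκ hΓ hf a).1 (hmin.isLocalMin univ_mem)
  have h2 := (hz.comparison hI hI' hh hh_pos hκ hΓ hf b).2 (hmax.isLocalMax univ_mem)
  constructor
  · refine lt_of_lt_of_le ?_ (hmin (mem_univ u))
    by_contra hle
    exact absurd (ha _ (hz.mem a) (not_lt.1 hle) a) (not_lt.2 h1)
  · refine lt_of_le_of_lt (hmax (mem_univ u)) ?_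
    by_contra hle
    exact absurd (hb _ (hz.mem b) (not_lt.1 hle) b) (not_lt.2 h2)

end Solution

/-! ### Bounds that are uniform on the compact manifold -/

section Uniform

variable {n : ℕ} {M : Type*} [TopologicalSpace M]
  [ChartedSpace (EuclideanSpace ℝ (Fin n)) M]
  {I : Set ℝ} {ψ : ℝ → M → ℝ} {e : OpenPartialHomeomorph M (EuclideanSpace ℝ (Fin n))}

theorem contDiffOn_chart_prod
    (hψ : ContMDiffOn (𝓘(ℝ, ℝ).prod (𝓡 n)) 𝓘(ℝ, ℝ) 1 (fun p : ℝ × M => ψ p.1 p.2) (I ×ˢ univ))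
    (he : e ∈ IsManifold.maximalAtlas (𝓡 n) ∞ M) :
    ContDiffOn ℝ 1 (fun p : ℝ × EuclideanSpace ℝ (Fin n) => ψ p.1 (e.symm p.2))
      (I ×ˢ e.target) := by
  have h1 : ContMDiffOn (𝓡 n) (𝓡 n) 1 e.symm e.target :=
    (contMDiffOn_symm_of_mem_maximalAtlas he).of_le (by norm_cast)
  have h2 : ContMDiffOn 𝓘(ℝ, ℝ × EuclideanSpace ℝ (Fin n)) (𝓡 n) 1
      (fun p : ℝ × EuclideanSpace ℝ (Fin n) => e.symm p.2) (I ×ˢ e.target) :=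
    h1.comp contDiff_snd.contMDiff.contMDiffOn fun p hp => hp.2
  have h3 : ContMDiffOn 𝓘(ℝ, ℝ × EuclideanSpace ℝ (Fin n)) 𝓘(ℝ, ℝ) 1
      (fun p : ℝ × EuclideanSpace ℝ (Fin n) => p.1) (I ×ˢ e.target) :=
    contDiff_fst.contMDiff.contMDiffOn
  exact (hψ.comp (h3.prodMk h2) fun p hp => ⟨hp.1, mem_univ _⟩).contDiffOn

variable [IsManifold (𝓡 n) ∞ M] {g : Metric n M}

/-- Bounds at `u`, in some chart around `u`, for the curvature of the metric and for the
differential of `ψ t`, `t ∈ [tm, tp]`. -/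
def HasChartBounds (g : Metric n M) (ψ : ℝ → M → ℝ) (tm tp : ℝ) (u : M) (C : ℝ) : Prop :=
  ∃ e ∈ IsManifold.maximalAtlas (𝓡 n) ∞ M, u ∈ e.source ∧
    CurvatureBound (chartForm g e) (e u) C ∧
    ∀ t ∈ Icc tm tp, ∀ w, |fderiv ℝ (fun p : ℝ × EuclideanSpace ℝ (Fin n) => ψ p.1 (e.symm p.2))
      (t, e u) (0, w)| ≤ C * √(chartForm g e (e u) w w)

theorem HasChartBounds.mono {tm tp : ℝ} {u : M} {C C' : ℝ} (H : HasChartBounds g ψ tm tp u C)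
    (hC : C ≤ C') : HasChartBounds g ψ tm tp u C' := by
  obtain ⟨e, he, hu, h1, h2⟩ := H
  have hnn : ∀ a, 0 ≤ chartForm g e (e u) a a := fun a => by
    rcases eq_or_ne a 0 with rfl | ha
    · simp
    · exact (chartForm_pos g he (e.map_source hu) a ha).le
  refine ⟨e, he, hu, fun Γ hΓ a w => ?_, fun t ht w => (h2 t ht w).trans ?_⟩
  · refine le_trans ?_ (h1 Γ hΓ a w)
    have := mul_nonneg (hnn a) (hnn w)
    nlinarith
  · gcongr

/-- A single chart at `u₀` serves all nearby points: the curvature bound and coercivity are open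
conditions, and coercivity converts the Euclidean norm of `w` into its `σ`-norm. -/
theorem eventually_hasChartBounds (g : Metric n M) (hI : IsOpen I)
    (hψ : ContMDiffOn (𝓘(ℝ, ℝ).prod (𝓡 n)) 𝓘(ℝ, ℝ) 1 (fun p : ℝ × M => ψ p.1 p.2) (I ×ˢ univ))
    {tm tp : ℝ} (hsub : Icc tm tp ⊆ I) (u₀ : M) :
    ∃ C : ℝ, ∀ᶠ u in 𝓝 u₀, HasChartBounds g ψ tm tp u C := by
  have he := IsManifold.chart_mem_maximalAtlas (I := 𝓡 n) (n := ∞) u₀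
  set e := chartAt (EuclideanSpace ℝ (Fin n)) u₀
  have hu₀ : u₀ ∈ e.source := mem_chart_source _ u₀
  have hx₀ : e u₀ ∈ e.target := e.map_source hu₀
  have hσ : ContDiffAt ℝ 2 (chartForm g e) (e u₀) :=
    (contDiffOn_chartForm g he).contDiffAt (e.open_target.mem_nhds hx₀)
  obtain ⟨C₁, hC₁, hcurv⟩ := eventually_curvatureBound hσ (chartForm_pos g he hx₀)
  obtain ⟨c, hc, hcoer⟩ := eventually_coercive hσ.continuousAt (chartForm_pos g he hx₀)
  set ψ' : ℝ × EuclideanSpace ℝ (Fin n) → ℝ := fun p => ψ p.1 (e.symm p.2) with hψ'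
  have hcont : ContinuousOn (fderiv ℝ ψ') (I ×ˢ e.target) :=
    (contDiffOn_chart_prod hψ he).continuousOn_fderiv_of_isOpen (hI.prod e.open_target) le_rfl
  obtain ⟨B, hB⟩ : ∃ B, ∀ t ∈ Icc tm tp, ‖fderiv ℝ ψ' (t, e u₀)‖ ≤ B := by
    refine isCompact_Icc.exists_bound_of_continuousOn (hcont.comp (by fun_prop) ?_)
    exact fun t ht => ⟨hsub ht, hx₀⟩
  -- Tube lemma: pointwise continuity of the differential plus compactness of `[tm, tp]` gives one
  -- neighbourhood for all `t`.
  have hev : ∀ᶠ x in 𝓝 (e u₀), ∀ t ∈ Icc tm tp, ‖fderiv ℝ ψ' (t, x)‖ ≤ |B| + 1 := by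
    refine isCompact_Icc.eventually_forall_of_forall_eventually fun t ht => ?_
    have h1 : ContinuousAt (fun p : EuclideanSpace ℝ (Fin n) × ℝ => ‖fderiv ℝ ψ' (p.2, p.1)‖)
        (e u₀, t) := by
      refine ContinuousAt.norm (ContinuousAt.comp (f := Prod.swap) ?_ (by fun_prop))
      exact hcont.continuousAt ((hI.prod e.open_target).mem_nhds ⟨hsub ht, hx₀⟩)
    have h2 : ‖fderiv ℝ ψ' (t, e u₀)‖ < |B| + 1 := by
      linarith [hB t ht, le_abs_self B]
    filter_upwards [h1.eventually (gt_mem_nhds h2)] with p hp using hp.le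
  refine ⟨max C₁ ((|B| + 1) / √c), ?_⟩
  have htend : Tendsto e (𝓝 u₀) (𝓝 (e u₀)) := e.continuousAt hu₀
  filter_upwards [htend.eventually (hcurv.and (hcoer.and hev)), e.open_source.mem_nhds hu₀]
    with u ⟨h1, h2, h3⟩ hu
  have hmax : HasChartBounds g ψ tm tp u (max C₁ ((|B| + 1) / √c)) := by
    have hnn : ∀ a, 0 ≤ chartForm g e (e u) a a := fun a =>
      (mul_nonneg hc.le (sq_nonneg _)).trans (h2 a)
    refine ⟨e, he, hu, fun Γ hΓ a w => le_trans ?_ (h1 Γ hΓ a w), fun t ht w => ?_⟩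
    · have h5 := mul_nonneg (hnn a) (hnn w)
      have h6 := le_max_left C₁ ((|B| + 1) / √c)
      nlinarith
    · have h5 : ‖w‖ ≤ √(chartForm g e (e u) w w) / √c := by
        rw [← Real.sqrt_div (hnn w), Real.le_sqrt (norm_nonneg _), le_div_iff₀ hc]
        · linarith [h2 w]
        · exact div_nonneg (hnn w) hc.le
      have h6 : ‖((0 : ℝ), w)‖ = ‖w‖ := by simp [Prod.norm_def]
      calc |fderiv ℝ ψ' (t, e u) (0, w)| ≤ ‖fderiv ℝ ψ' (t, e u)‖ * ‖((0 : ℝ), w)‖ :=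
            (fderiv ℝ ψ' (t, e u)).le_opNorm _
        _ ≤ (|B| + 1) * (√(chartForm g e (e u) w w) / √c) := by
            rw [h6]; gcongr; exact h3 t ht
        _ = (|B| + 1) / √c * √(chartForm g e (e u) w w) := by ring
        _ ≤ _ := by gcongr; exact le_max_right _ _
  exact hmax

/-- The chart in `HasChartBounds` may vary with the point, so local constants combine: the existence
of a bound passes to subsets and unions, hence to the compact `M`. -/
theorem exists_hasChartBounds [CompactSpace M] (g : Metric n M) (hI : IsOpen I)
    (hψ : ContMDiffOn (𝓘(ℝ, ℝ).prod (𝓡 n)) 𝓘(ℝ, ℝ) 1 (fun p : ℝ × M => ψ p.1 p.2) (I ×ˢ univ))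
    {tm tp : ℝ} (hsub : Icc tm tp ⊆ I) : ∃ C : ℝ, 0 ≤ C ∧ ∀ u, HasChartBounds g ψ tm tp u C := by
  have key : ∃ C : ℝ, ∀ u ∈ (univ : Set M), HasChartBounds g ψ tm tp u C := by
    refine isCompact_univ.induction_on (p := fun s => ∃ C : ℝ, ∀ u ∈ s, HasChartBounds g ψ tm tp u C)
      ⟨0, by simp⟩ ?_ ?_ ?_
    · rintro s t hst ⟨C, hC⟩
      exact ⟨C, fun u hu => hC u (hst hu)⟩
    · rintro s t ⟨C, hC⟩ ⟨C', hC'⟩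
      refine ⟨max C C', ?_⟩
      rintro u (hu | hu)
      · exact (hC u hu).mono (le_max_left _ _)
      · exact (hC' u hu).mono (le_max_right _ _)
    · intro u _
      obtain ⟨C, hC⟩ := eventually_hasChartBounds g hI hψ hsub u
      exact ⟨_, mem_nhdsWithin_of_mem_nhds hC, C, fun u hu => hu⟩
  obtain ⟨C, hC⟩ := key
  exact ⟨max C 0, le_max_right _ _, fun u => (hC u (mem_univ u)).mono (le_max_left _ _)⟩

end Uniform

/-! ### The right-hand side of the equation -/

section RightHandSide

variable {n : ℕ} {M : Type*} {I : Set ℝ} {h : ℝ → ℝ} {Γ : Set (Fin n → ℝ)} {f : (Fin n → ℝ) → ℝ}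
  {ψ : ℝ → M → ℝ} {φ : ℝ → ℝ} {tm tp s t : ℝ}

theorem leafValue_pos (hΓ : IsSymmetricCone Γ) (hf : IsCurvatureFunction Γ f)
    (hκ : 0 < kappa h t) : 0 < leafValue f h t :=
  hf.pos _ (hΓ.const_mem hκ)

/-- `Ψ` is a convex combination of `ψ` and `φ k`, and below `tm` both exceed `k`. So every member of
the homotopy has the same barriers. -/
theorem IsHomotopyWeight.leafValue_lt (hφ : IsHomotopyWeight I f h ψ tm tp φ) (hs : s ∈ Icc (0 : ℝ) 1)
    (ht : t ∈ I) (htm : t ≤ tm) {u : M} (hpos : 0 < leafValue f h t)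
    (hlt : leafValue f h t < ψ t u) : leafValue f h t < homotopyRHS f h ψ φ s t u := by
  have h1 := hφ.one_lt t ht htm
  have h2 : leafValue f h t < φ t * leafValue f h t := by nlinarith
  unfold homotopyRHS
  rcases hs.1.eq_or_lt with h0 | h0
  · rw [← h0]; linarith
  · nlinarith [hs.2]

theorem IsHomotopyWeight.lt_leafValue (hφ : IsHomotopyWeight I f h ψ tm tp φ) (hs : s ∈ Icc (0 : ℝ) 1)
    (ht : t ∈ I) (htp : tp ≤ t) {u : M} (hpos : 0 < leafValue f h t)
    (hlt : ψ t u < leafValue f h t) : homotopyRHS f h ψ φ s t u < leafValue f h t := by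
  have h1 := hφ.lt_one t ht htp
  have h2 : φ t * leafValue f h t < leafValue f h t := by nlinarith
  unfold homotopyRHS
  rcases hs.1.eq_or_lt with h0 | h0
  · rw [← h0]; linarith
  · nlinarith [hs.2]

theorem differentiableAt_leafValue (hI : IsOpen I) (hh : ContDiffOn ℝ 2 h I)
    (hh_pos : ∀ t ∈ I, 0 < h t) (hκ : ∀ t ∈ I, 0 < kappa h t) (hΓ : IsSymmetricCone Γ)
    (hf : IsCurvatureFunction Γ f) (ht : t ∈ I) : DifferentiableAt ℝ (leafValue f h) t := by
  have h1 : DifferentiableAt ℝ (deriv h) t := by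
    have h2 : ContDiffOn ℝ 1 (deriv h) I := hh.deriv_of_isOpen hI (by norm_num)
    exact (h2.contDiffAt (hI.mem_nhds ht)).differentiableAt (by simp)
  have h3 : DifferentiableAt ℝ h t := (hh.contDiffAt (hI.mem_nhds ht)).differentiableAt (by simp)
  have h4 : DifferentiableAt ℝ (kappa h) t := h1.div h3 (hh_pos t ht).ne'
  have h5 : DifferentiableAt ℝ f (fun _ => kappa h t) :=
    (hf.contDiffOn.contDiffAt (hΓ.isOpen.mem_nhds (hΓ.const_mem (hκ t ht)))).differentiableAt
      (by simp)
  exact h5.comp t (f := fun t => (fun _ : Fin n => kappa h t)) (differentiableAt_pi.2 fun _ => h4)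

end RightHandSide

section Homotopy

variable {n : ℕ} {M : Type*} [TopologicalSpace M]
  [ChartedSpace (EuclideanSpace ℝ (Fin n)) M] [IsManifold (𝓡 n) ∞ M]
  {I : Set ℝ} {h : ℝ → ℝ} {Γ : Set (Fin n → ℝ)} {f : (Fin n → ℝ) → ℝ}
  {ψ : ℝ → M → ℝ} {φ : ℝ → ℝ} {tm tp s : ℝ}
  {e : OpenPartialHomeomorph M (EuclideanSpace ℝ (Fin n))}

/-- The derivative of `Ψ` along the graph, split into its `t`-part and its `u`-part. -/
theorem exists_hasDerivAt_homotopyRHS (hI : IsOpen I) (hh : ContDiffOn ℝ 2 h I)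
    (hh_pos : ∀ t ∈ I, 0 < h t) (hκ : ∀ t ∈ I, 0 < kappa h t) (hΓ : IsSymmetricCone Γ)
    (hf : IsCurvatureFunction Γ f) (hφ : IsHomotopyWeight I f h ψ tm tp φ)
    (hψ : ContMDiffOn (𝓘(ℝ, ℝ).prod (𝓡 n)) 𝓘(ℝ, ℝ) 1 (fun p : ℝ × M => ψ p.1 p.2) (I ×ˢ univ))
    (hc : ∀ t ∈ Ioo tm tp, ∀ u, deriv (fun r => h r * ψ r u) t ≤ 0) (hs : s ∈ Icc (0 : ℝ) 1)
    (he : e ∈ IsManifold.maximalAtlas (𝓡 n) ∞ M) {x : EuclideanSpace ℝ (Fin n)}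
    (hx : x ∈ e.target) {t : ℝ} (ht : t ∈ I) (ht' : t ∈ Ioo tm tp) :
    ∃ Ψt : ℝ, Ψt + kappa h t * homotopyRHS f h ψ φ s t (e.symm x) ≤ 0 ∧
      ∀ (Z : EuclideanSpace ℝ (Fin n) → ℝ), Z x = t → DifferentiableAt ℝ Z x → ∀ w,
        HasDerivAt (fun a : ℝ => homotopyRHS f h ψ φ s (Z (x + a • w)) (e.symm (x + a • w)))
          (Ψt * fderiv ℝ Z x w + s * fderiv ℝ
            (fun p : ℝ × EuclideanSpace ℝ (Fin n) => ψ p.1 (e.symm p.2)) (t, x) (0, w)) 0 := by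
  set ψ' : ℝ × EuclideanSpace ℝ (Fin n) → ℝ := fun p => ψ p.1 (e.symm p.2) with hψ'
  have hψd : HasFDerivAt ψ' (fderiv ℝ ψ' (t, x)) (t, x) :=
    (((contDiffOn_chart_prod hψ he).contDiffAt
      ((hI.prod e.open_target).mem_nhds ⟨ht, hx⟩)).differentiableAt (by simp)).hasFDerivAt
  have hφd : HasDerivAt φ (deriv φ t) t :=
    ((hφ.contDiffOn.contDiffAt (hI.mem_nhds ht)).differentiableAt (by simp)).hasDerivAt
  have hkd : HasDerivAt (leafValue f h) (deriv (leafValue f h) t) t :=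
    (differentiableAt_leafValue hI hh hh_pos hκ hΓ hf ht).hasDerivAt
  have hhd : HasDerivAt h (deriv h t) t :=
    ((hh.contDiffAt (hI.mem_nhds ht)).differentiableAt (by simp)).hasDerivAt
  have hφk := hφd.mul hkd
  set P := deriv φ t * leafValue f h t + φ t * deriv (leafValue f h) t
  have hψt : HasDerivAt (fun r => ψ r (e.symm x)) (fderiv ℝ ψ' (t, x) (1, 0)) t :=
    HasFDerivAt.comp_hasDerivAt (l := ψ') (f := fun r => (r, x)) t hψd ((hasDerivAt_id t).prodMk (hasDerivAt_const t x))
  have hΨt : HasDerivAt (fun r => homotopyRHS f h ψ φ s r (e.symm x))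
      (s * fderiv ℝ ψ' (t, x) (1, 0) + (1 - s) * P) t :=
    (hψt.const_mul s).add (hφk.const_mul (1 - s))
  refine ⟨s * fderiv ℝ ψ' (t, x) (1, 0) + (1 - s) * P, ?_, fun Z hZ hZd w => ?_⟩
  -- The condition on `φ` covers `s < 1` only. At `s = 1` the function `φ` drops out and the
  -- inequality is `∂_t(hψ) ≤ 0` divided by `h`.
  · rcases hs.2.eq_or_lt with h1 | h1
    · subst h1
      have h2 := hc t ht' (e.symm x)
      rw [(hhd.fun_mul hψt).deriv] at h2
      have h3 := hh_pos t ht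
      simp only [homotopyRHS, kappa, sub_self, zero_mul, add_zero, one_mul]
      have h4 : fderiv ℝ ψ' (t, x) (1, 0) + deriv h t / h t * ψ t (e.symm x)
          = (deriv h t * ψ t (e.symm x) + h t * fderiv ℝ ψ' (t, x) (1, 0)) / h t := by
        field_simp
        ring
      rw [h4]
      exact div_nonpos_of_nonpos_of_nonneg h2 h3.le
    · have h2 := hφ.homotopy_neg s ⟨hs.1, h1⟩ t ht' (e.symm x)
      rw [hΨt.deriv] at h2
      exact h2.le
  · have hZl := hasDerivAt_line_zero x w hZd
    have hxl : HasDerivAt (fun a : ℝ => x + a • w) w 0 := by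
      simpa using ((hasDerivAt_id (0 : ℝ)).smul_const w).const_add x
    have hZ0 : Z (x + (0 : ℝ) • w) = t := by simpa using hZ
    have h0 : (Z (x + (0 : ℝ) • w), x + (0 : ℝ) • w) = (t, x) := by simp [hZ]
    have h1 : HasDerivAt (fun a : ℝ => ψ' (Z (x + a • w), x + a • w))
        (fderiv ℝ ψ' (t, x) (fderiv ℝ Z x w, w)) 0 :=
      HasFDerivAt.comp_hasDerivAt (l := ψ') (f := fun a : ℝ => (Z (x + a • w), x + a • w)) 0
        (by rw [h0]; exact hψd) (hZl.prodMk hxl)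
    have h2 : HasDerivAt (fun a : ℝ => φ (Z (x + a • w)) * leafValue f h (Z (x + a • w)))
        (P * fderiv ℝ Z x w) 0 :=
      HasDerivAt.comp (h := fun a : ℝ => Z (x + a • w)) (h₂ := fun t => φ t * leafValue f h t) 0
        (by rw [hZ0]; exact hφk) hZl
    have h3 : fderiv ℝ ψ' (t, x) (fderiv ℝ Z x w, w)
        = fderiv ℝ Z x w * fderiv ℝ ψ' (t, x) (1, 0) + fderiv ℝ ψ' (t, x) (0, w) := by
      have : (fderiv ℝ Z x w, w) = fderiv ℝ Z x w • ((1 : ℝ), (0 : EuclideanSpace ℝ (Fin n)))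
          + (0, w) := by simp
      rw [this, map_add, map_smul, smul_eq_mul]
    refine ((h1.const_mul s).add (h2.const_mul (1 - s))).congr_deriv ?_
    rw [h3]
    ring

end Homotopy

/-! ### The gradient estimate -/

/-- The differentiated equation at a maximum bounds `G = |∇ (r ∘ z)|²`. -/
theorem lt_of_maximum_inequality {H H' H'' b m C K L G F S Ψ Ψt d f₁ : ℝ} (hH : 0 < H)
    (hH' : 0 < H') (hm : 0 < m) (hC : 0 ≤ C) (hL : 0 ≤ L) (hF : 0 ≤ F) (hSΨ : S ≤ Ψ)
    (hf₁ : f₁ ≤ Ψ - S + F) (hHb : H ≤ b) (hmH : m ≤ H * H') (hK : L + 1 ≤ H * H'' + K * H' - C)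
    (hLf : 2 * b * C < L * f₁) (hΨt : Ψt + H' / H * Ψ ≤ 0) (hd : |d| ≤ C * √G)
    (hmain : F * (G * (H * H'' + K * H' - C) - K ^ 2 / 4) - G * H' * H * √(1 + G) * S
      ≤ H * √(1 + G) * (Ψt * (H * G) + d)) :
    G < 1 + K ^ 2 / 4 + (L / m) ^ 2 := by
  -- Each summand of the threshold has a use: `1 ≤ G` gives `√(1+G) ≤ 2√G`, `K²/4 ≤ G` absorbs the
  -- completed square, and `(L/m)² ≤ G` gives `L ≤ m√G`.
  by_contra! hge
  have hK2 := sq_nonneg K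
  have hLm := sq_nonneg (L / m)
  have hG1 : 1 ≤ G := by linarith
  have hGK : K ^ 2 / 4 ≤ G := by linarith
  have hGL : L ≤ m * √G := by
    have : L / m ≤ √G := Real.le_sqrt_of_sq_le (by linarith)
    rw [div_le_iff₀ hm] at this
    linarith
  set q := √(1 + G)
  set r := √G
  have hr0 : 0 ≤ r := Real.sqrt_nonneg _
  have hr2 : r * r = G := Real.mul_self_sqrt (by linarith)
  have hrq : r ≤ q := Real.sqrt_le_sqrt (by linarith)
  have hq2 : q ≤ 2 * r := by
    refine Real.sqrt_le_iff.2 ⟨by positivity, ?_⟩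
    nlinarith
  have hq0 : 0 ≤ q := hr0.trans hrq
  have hΨt' : Ψt * H ≤ -(H' * Ψ) := by
    have h1 : (Ψt + H' / H * Ψ) * H ≤ 0 := mul_nonpos_of_nonpos_of_nonneg hΨt hH.le
    have h2 : (Ψt + H' / H * Ψ) * H = Ψt * H + H' * Ψ := by field_simp
    linarith
  have hG0 : 0 ≤ G := by linarith
  have hright : H * q * (Ψt * (H * G) + d) ≤ H * q * (G * -(H' * Ψ)) + 2 * b * C * G := by
    have h1 : H * q * (G * (Ψt * H)) ≤ H * q * (G * -(H' * Ψ)) := by gcongr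
    have h2 : H * q * d ≤ H * (2 * r) * (C * r) := by
      have h3 : d ≤ C * r := (le_abs_self d).trans hd
      have h4 : 0 ≤ C * r := by positivity
      calc H * q * d ≤ H * q * (C * r) := by gcongr
        _ ≤ _ := by gcongr
    have h5 : H * (2 * r) * (C * r) ≤ 2 * b * C * G := by
      have : H * (2 * r) * (C * r) = H * (2 * C * G) := by rw [← hr2]; ring
      rw [this]
      calc H * (2 * C * G) ≤ b * (2 * C * G) := by gcongr
        _ = _ := by ring
    linarith [h1, h2, h5, show H * q * (Ψt * (H * G) + d) = H * q * (G * (Ψt * H)) + H * q * d by ring]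
  -- The extra `1` in `hK` pays for `K²/4 ≤ G`.
  have hleft : G * L * F ≤ F * (G * (H * H'' + K * H' - C) - K ^ 2 / 4) := by
    have h1 : G * (L + 1) ≤ G * (H * H'' + K * H' - C) := by gcongr
    have h2 : F * (G * L) ≤ F * (G * (H * H'' + K * H' - C) - K ^ 2 / 4) := by
      gcongr
      linarith
    linarith
  -- The nonnegative defect `Ψ - S` carries a factor growing like `√G`, so it gets the same
  -- coefficient `G * L` as `F`.
  have hmid : G * L * (Ψ - S) ≤ G * H' * H * q * (Ψ - S) := by
    have h1 : L ≤ H' * H * q := by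
      calc L ≤ m * r := hGL
        _ ≤ (H * H') * q := by gcongr
        _ = _ := by ring
    have h2 : 0 ≤ Ψ - S := by linarith
    calc G * L * (Ψ - S) ≤ G * (H' * H * q) * (Ψ - S) := by gcongr
      _ = _ := by ring
  -- Now `F` and `Ψ - S` have a common coefficient and `hf₁` bounds their sum from below.
  have hsum : G * (L * f₁) ≤ G * (2 * b * C) := by
    have h1 : G * L * f₁ ≤ G * L * (Ψ - S + F) := by gcongr
    nlinarith
  have := le_of_mul_le_mul_left hsum (by linarith)
  linarith

section Estimate

variable {n : ℕ} {M : Type*} [TopologicalSpace M]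
  [ChartedSpace (EuclideanSpace ℝ (Fin n)) M] [IsManifold (𝓡 n) ∞ M] {g : Metric n M}
  {I : Set ℝ} {h : ℝ → ℝ} {Γ : Set (Fin n → ℝ)} {f : (Fin n → ℝ) → ℝ}
  {ψ : ℝ → M → ℝ} {φ : ℝ → ℝ} {tm tp s : ℝ} {z : M → ℝ} {r : ℝ → ℝ}
  {e : OpenPartialHomeomorph M (EuclideanSpace ℝ (Fin n))}

/-- `r` gains one derivative over `h`, so `r ∘ z` is still three times differentiable, as the
maximum argument requires. -/
theorem contDiffOn_primitive (hI : IsOpen I) (hh : ContDiffOn ℝ 2 h I)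
    (hh_pos : ∀ t ∈ I, 0 < h t) (hr : ∀ t ∈ I, HasDerivAt r (h t)⁻¹ t) : ContDiffOn ℝ 3 r I := by
  have h1 : ContDiffOn ℝ (2 + 1) r I := by
    rw [contDiffOn_succ_iff_deriv_of_isOpen hI]
    refine ⟨fun t ht => (hr t ht).differentiableAt.differentiableWithinAt, by simp, ?_⟩
    exact (hh.inv fun t ht => (hh_pos t ht).ne').congr fun t ht => (hr t ht).deriv
  exact h1.of_le (by norm_num)

theorem fderiv_gradField_comp (hI : IsOpen I) (hzI : ∀ u, z u ∈ I)
    (hz : ContMDiff (𝓡 n) 𝓘(ℝ, ℝ) 3 z) (hr : ∀ t ∈ I, HasDerivAt r (h t)⁻¹ t)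
    (he : e ∈ IsManifold.maximalAtlas (𝓡 n) ∞ M) {x : EuclideanSpace ℝ (Fin n)}
    (hx : x ∈ e.target) :
    fderiv ℝ (fun y => r (z (e.symm y))) x
        (gradField (chartForm g e) (fun y => r (z (e.symm y))) x)
      = (gradientNorm g z (e.symm x) / h (z (e.symm x))) ^ 2 := by
  have hZ : ContDiffAt ℝ 3 (fun y => z (e.symm y)) x :=
    (contDiffOn_chart he hz).contDiffAt (e.open_target.mem_nhds hx)
  have hr' : ∀ᶠ t in 𝓝 (z (e.symm x)), HasDerivAt r (h t)⁻¹ t := by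
    filter_upwards [hI.mem_nhds (hzI _)] with t ht using hr t ht
  have h1 := apply_gradField (v := fun y => z (e.symm y)) (chartForm_pos g he hx)
  have h2 : 0 ≤ fderiv ℝ (fun y => z (e.symm y)) x
      (gradField (chartForm g e) (fun y => z (e.symm y)) x) := by
    rw [← h1]
    rcases eq_or_ne (gradField (chartForm g e) (fun y => z (e.symm y)) x) 0 with h0 | h0
    · simp [h0]
    · exact (chartForm_pos g he hx _ h0).le
  rw [fderiv_comp_inv hZ hr', gradField_comp_inv (h := h) hZ _ hr', map_smul,
    gradientNorm_chart g he hz hx, div_pow, Real.sq_sqrt h2, smul_eq_mul]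
  field_simp

/-- The gradient bound at a maximum of `½ log (1 + |∇(r ∘ z)|²) + K r(z)`. -/
theorem IsSolution.gradient_lt_of_isMax (hI : IsOpen I) (hh : ContDiffOn ℝ 2 h I)
    (hh_pos : ∀ t ∈ I, 0 < h t) (hκ : ∀ t ∈ I, 0 < kappa h t) (hΓ : IsSymmetricCone Γ)
    (hf : IsCurvatureFunction Γ f) (hφ : IsHomotopyWeight I f h ψ tm tp φ)
    (hψ : ContMDiffOn (𝓘(ℝ, ℝ).prod (𝓡 n)) 𝓘(ℝ, ℝ) 1 (fun p : ℝ × M => ψ p.1 p.2) (I ×ˢ univ))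
    (hc : ∀ t ∈ Ioo tm tp, ∀ u, deriv (fun r => h r * ψ r u) t ≤ 0) (hs : s ∈ Icc (0 : ℝ) 1)
    (hz : IsSolution I g h Γ f (homotopyRHS f h ψ φ s) z)
    (hr : ∀ t ∈ I, HasDerivAt r (h t)⁻¹ t) {b m C K L : ℝ} (hm : 0 < m) (hC : 0 ≤ C) (hL : 0 ≤ L)
    {u : M} (hu : z u ∈ Ioo tm tp) (hbounds : HasChartBounds g ψ tm tp u C)
    (hb : h (z u) ≤ b) (hmu : m ≤ h (z u) * deriv h (z u))
    (hK : L + 1 ≤ h (z u) * deriv (deriv h) (z u) + K * deriv h (z u) - C)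
    (hLf : 2 * b * C < L * f fun _ => 1)
    (hmax : ∀ u', Real.log (1 + (gradientNorm g z u' / h (z u')) ^ 2) / 2 + K * r (z u')
      ≤ Real.log (1 + (gradientNorm g z u / h (z u)) ^ 2) / 2 + K * r (z u)) :
    (gradientNorm g z u / h (z u)) ^ 2 < 1 + K ^ 2 / 4 + (L / m) ^ 2 := by
  obtain ⟨e, he, hue, hcurv, hdψ⟩ := hbounds
  have hzI := hz.mem u
  have hx : e u ∈ e.target := e.map_source hue
  have hinv : e.symm (e u) = u := e.left_inv hue
  have hnhds := e.open_target.mem_nhds hx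
  have hH := hh_pos _ hzI
  have hH' : 0 < deriv h (z u) := (div_pos_iff_of_pos_right hH).1 (hκ _ hzI)
  have hZ : ContDiffAt ℝ 3 (fun y => z (e.symm y)) (e u) :=
    (contDiffOn_chart he hz.contMDiff).contDiffAt hnhds
  have hZd := hZ.differentiableAt (by simp)
  have hr' : ∀ᶠ t in 𝓝 (z (e.symm (e u))), HasDerivAt r (h t)⁻¹ t := by
    rw [hinv]
    filter_upwards [hI.mem_nhds hzI] with t ht using hr t ht
  set v : EuclideanSpace ℝ (Fin n) → ℝ := fun y => r (z (e.symm y)) with hv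
  set w := gradField (chartForm g e) v with hw
  have hG : ∀ y ∈ e.target, fderiv ℝ v y (w y)
      = (gradientNorm g z (e.symm y) / h (z (e.symm y))) ^ 2 := fun y hy =>
    fderiv_gradField_comp hI hz.mem hz.contMDiff hr he hy
  have hGu : fderiv ℝ v (e u) (w (e u)) = (gradientNorm g z u / h (z u)) ^ 2 := by
    rw [hG _ hx, hinv]
  have hvd : ContDiffAt ℝ 3 v (e u) := by
    refine ContDiffAt.comp (e u) (g := r) ?_ hZ
    rw [hinv]
    exact (contDiffOn_primitive hI hh hh_pos hr).contDiffAt (hI.mem_nhds hzI)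
  have hlg : IsLocalGradient (chartForm g e) v w (e u) := by
    refine isLocalGradient_gradField ((contDiffOn_chartForm g he).contDiffAt hnhds)
      (Eventually.of_forall fun y => chartForm_symm g y) ?_ hvd
    filter_upwards [hnhds] with y hy using chartForm_pos g he hy
  have hlmax : IsLocalMax (fun y => Real.log (1 + fderiv ℝ v y (w y)) / 2 + K * v y) (e u) := by
    filter_upwards [hnhds] with y hy
    rw [hG y hy, hGu]
    simpa only [hv, hinv] using hmax (e.symm y)
  have hdv : fderiv ℝ (fun y => z (e.symm y)) (e u) (w (e u))
      = h (z u) * fderiv ℝ v (e u) (w (e u)) := by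
    rw [hv, fderiv_comp_inv hZ hr', hinv, mul_inv_cancel_left₀ hH.ne']
  have hZ0 : z (e.symm (e u + (0 : ℝ) • w (e u))) = z u := by simp [hinv]
  have hline := hasDerivAt_line_zero (φ := fun y => z (e.symm y)) (e u) (w (e u)) hZd
  rw [hdv] at hline
  have hhd : HasDerivAt h (deriv h (z u)) (z u) :=
    ((hh.contDiffAt (hI.mem_nhds hzI)).differentiableAt (by simp)).hasDerivAt
  have hhd' : HasDerivAt (deriv h) (deriv (deriv h) (z u)) (z u) := by
    have h1 : ContDiffOn ℝ 1 (deriv h) I := hh.deriv_of_isOpen hI (by norm_num)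
    exact ((h1.contDiffAt (hI.mem_nhds hzI)).differentiableAt (by simp)).hasDerivAt
  have hd₀ : HasDerivAt (fun a : ℝ => h (z (e.symm (e u + a • w (e u)))))
      (h (z u) * deriv h (z u) * fderiv ℝ v (e u) (w (e u))) 0 :=
    (HasDerivAt.comp (h₂ := h) (h := fun a : ℝ => z (e.symm (e u + a • w (e u)))) 0
      (by rw [hZ0]; exact hhd) hline).congr_deriv (by ring)
  have hd₁ : HasDerivAt (fun a : ℝ => deriv h (z (e.symm (e u + a • w (e u)))))
      (h (z u) * deriv (deriv h) (z u) * fderiv ℝ v (e u) (w (e u))) 0 :=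
    (HasDerivAt.comp (h₂ := deriv h) (h := fun a : ℝ => z (e.symm (e u + a • w (e u)))) 0
      (by rw [hZ0]; exact hhd') hline).congr_deriv (by ring)
  obtain ⟨Ψt, hΨt, hdΨ⟩ := exists_hasDerivAt_homotopyRHS hI hh hh_pos hκ hΓ hf hφ hψ hc hs he hx
    hzI hu
  have hdΨ := hdΨ (fun y => z (e.symm y)) (by simp [hinv]) hZd (w (e u))
  rw [hdv] at hdΨ
  have heq : ∀ᶠ a : ℝ in 𝓝 0, LocalEquation Γ f (chartForm g e) v w
      (h (z (e.symm (e u + a • w (e u))))) (deriv h (z (e.symm (e u + a • w (e u)))))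
      (homotopyRHS f h ψ φ s (z (e.symm (e u + a • w (e u)))) (e.symm (e u + a • w (e u))))
      (e u + a • w (e u)) := by
    filter_upwards [(tendsto_line (e u) (w (e u))).eventually hnhds] with a ha
    have := hz.localEquation hI hh hh_pos hr he (e.map_target ha)
    rwa [e.right_inv ha] at this
  obtain ⟨l, hl, hfl, hmain⟩ := hlg.equation_at_maximum finrank_euclideanSpace_fin hΓ hf
    (chartForm_pos g he hx) hH hC hlmax hcurv hd₀ (by simp [hinv]) hd₁ (by simp [hinv]) hdΨ heq
  simp only [zero_smul, add_zero, hinv] at hfl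
  rw [hinv] at hΨt
  have hww : chartForm g e (e u) (w (e u)) (w (e u)) = fderiv ℝ v (e u) (w (e u)) := by
    rw [hlg.eq.self_of_nhds]
  have hd := hdψ (z u) ⟨hu.1.le, hu.2.le⟩ (w (e u))
  rw [hww] at hd
  rw [← hGu]
  refine lt_of_maximum_inequality (f₁ := f fun _ => 1) hH hH' hm hC hL
    (Finset.sum_nonneg fun i _ => (hf.partialDeriv_pos l hl i).le) ((hf.sum_mul_le hΓ hl).trans_eq hfl)
    ?_ hb hmu hK hLf hΨt ?_ hmain
  · rw [← hfl]
    exact hf.one_le_sum hΓ hl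
  -- The `u`-derivative of `Ψ` is `s` times that of `ψ`, so `s ≤ 1` makes the bound independent of
  -- `s`.
  · rw [abs_mul, abs_of_nonneg hs.1]
    exact (mul_le_of_le_one_left (abs_nonneg _) hs.2).trans hd

end Estimate

end WarpedGraph
end

/-! ### The gradient estimate: choice of constants -/

open WarpedGraph in
theorem proposition9 {n : ℕ} {M : Type*} [TopologicalSpace M] [T2Space M] [CompactSpace M]
    [ChartedSpace (EuclideanSpace ℝ (Fin n)) M] [IsManifold (𝓡 n) ∞ M]
    (g : WarpedGraph.Metric n M)
    (I : Set ℝ) (hI : IsOpen I) (hI' : I.OrdConnected)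
    (h : ℝ → ℝ) (hh : ContDiffOn ℝ 2 h I) (hh_pos : ∀ t ∈ I, 0 < h t)
    (hκ : ∀ t ∈ I, 0 < kappa h t)
    (Γ : Set (Fin n → ℝ)) (hΓ : IsSymmetricCone Γ)
    (f : (Fin n → ℝ) → ℝ) (hf : IsCurvatureFunction Γ f) (hfδ : StructureCondition Γ f)
    (tm tp : ℝ) (htm : tm ∈ I) (htp : tp ∈ I) (ht : tm < tp)
    (ψ : ℝ → M → ℝ)
    (hψ : ContMDiffOn (𝓘(ℝ, ℝ).prod (𝓡 n)) 𝓘(ℝ, ℝ) 1 (fun p : ℝ × M => ψ p.1 p.2) (I ×ˢ univ))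
    (hψ_pos : ∀ t ∈ I, ∀ u, 0 < ψ t u)
    (hlim : ∃ b b' : ℝ, b < b' ∧ (∀ t ∈ Icc tm tp, ∀ u, b' ≤ ψ t u) ∧ BoundaryLimsupLE Γ f b)
    (ha : ∀ t ∈ I, t ≤ tm → ∀ u, leafValue f h t < ψ t u)
    (hb : ∀ t ∈ I, tp ≤ t → ∀ u, ψ t u < leafValue f h t)
    (hc : ∀ t ∈ Ioo tm tp, ∀ u, deriv (fun r => h r * ψ r u) t ≤ 0) :
    ∃ C : ℝ, ∀ φ : ℝ → ℝ, IsHomotopyWeight I f h ψ tm tp φ →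
      ∀ s ∈ Icc (0 : ℝ) 1, ∀ z : M → ℝ,
        IsSolution I g h Γ f (homotopyRHS f h ψ φ s) z →
          ∀ u : M, gradientNorm g z u < C := by
  have hsub : Icc tm tp ⊆ I := hI'.out htm htp
  have hne : (Icc tm tp).Nonempty := nonempty_Icc.2 ht.le
  have hdh : ContDiffOn ℝ 1 (deriv h) I := hh.deriv_of_isOpen hI (by norm_num)
  have hddh : ContinuousOn (deriv (deriv h)) I := hdh.continuousOn_deriv_of_isOpen hI le_rfl
  have hdh_pos : ∀ t ∈ I, 0 < deriv h t := fun t ht =>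
    (div_pos_iff_of_pos_right (hh_pos t ht)).1 (hκ t ht)
  obtain ⟨r, hr⟩ := exists_primitive_inv hI hI' hh.continuousOn hh_pos htm
  have hrc : ContinuousOn r I := fun t ht => (hr t ht).continuousAt.continuousWithinAt
  obtain ⟨C, hC, hbounds⟩ := exists_hasChartBounds g hI hψ hsub
  obtain ⟨b, hb'⟩ := isCompact_Icc.exists_bound_of_continuousOn (hh.continuousOn.mono hsub)
  obtain ⟨B, hB⟩ := isCompact_Icc.exists_bound_of_continuousOn
    ((hh.continuousOn.mul hddh).mono hsub)
  obtain ⟨R, hR⟩ := isCompact_Icc.exists_bound_of_continuousOn (hrc.mono hsub)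
  obtain ⟨t₁, ht₁, hmin₁⟩ := isCompact_Icc.exists_isMinOn hne
    ((hh.continuousOn.mul hdh.continuousOn).mono hsub)
  obtain ⟨t₂, ht₂, hmin₂⟩ := isCompact_Icc.exists_isMinOn hne (hdh.continuousOn.mono hsub)
  set m := h t₁ * deriv h t₁ with hm_def
  have hm : 0 < m := mul_pos (hh_pos _ (hsub ht₁)) (hdh_pos _ (hsub ht₁))
  have hd₂ : 0 < deriv h t₂ := hdh_pos _ (hsub ht₂)
  have hf1 : 0 < f fun _ => 1 := hf.pos _ (hΓ.const_mem one_pos)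
  have hb0 : 0 ≤ b := (norm_nonneg _).trans (hb' tm ⟨le_rfl, ht.le⟩)
  have hB0 : 0 ≤ B := (norm_nonneg _).trans (hB tm ⟨le_rfl, ht.le⟩)
  -- Chosen so that `L f(1,…,1) = 2bC + 1` just exceeds the error coefficient `2bC`.
  set L := (2 * b * C + 1) / f fun _ => 1 with hL_def
  have hL : 0 ≤ L := by positivity
  -- With `deriv h t₂` the minimum of `h'` and `|h h''| ≤ B`, this forces `h h'' + K h' - C ≥ L + 1`
  -- on all of `[tm, tp]`.
  set K := (L + 1 + C + B) / deriv h t₂ with hK_def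
  have hK0 : 0 ≤ K := by positivity
  set G₀ := 1 + K ^ 2 / 4 + (L / m) ^ 2 with hG₀
  have hG₀_pos : 0 < G₀ := by positivity
  -- The oscillation of `K r(z)` is at most `2KR`, doubled by the factor `½` before the logarithm.
  -- None of these constants involves `φ`, `s` or `z`.
  refine ⟨b * ((1 + G₀) * Real.exp (4 * (K * R))) + 1, fun φ hφ s hs z hz u => ?_⟩
  have hzc : Continuous z := hz.contMDiff.continuous
  have hzIoo : ∀ u, z u ∈ Ioo tm tp := hz.mem_Ioo hI hI' hh hh_pos hκ hΓ hf
    (fun t ht htm u => hφ.leafValue_lt hs ht htm (leafValue_pos hΓ hf (hκ t ht)) (ha t ht htm u))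
    (fun t ht htp u => hφ.lt_leafValue hs ht htp (leafValue_pos hΓ hf (hκ t ht)) (hb t ht htp u))
  have hzIcc : ∀ u, z u ∈ Icc tm tp := fun u => Ioo_subset_Icc_self (hzIoo u)
  set q : M → ℝ := fun u => gradientNorm g z u / h (z u) with hq
  have hqc : Continuous q := (continuous_gradientNorm g hz.contMDiff).div
    (hh.continuousOn.comp_continuous hzc hz.mem) fun u => (hh_pos _ (hz.mem u)).ne'
  have hΦc : Continuous fun u => Real.log (1 + q u ^ 2) / 2 + K * r (z u) := by
    refine ((Continuous.log (by fun_prop) fun u => by positivity).div_const 2).add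
      (continuous_const.mul (hrc.comp_continuous hzc hz.mem))
  obtain ⟨u₀, -, hmax⟩ := isCompact_univ.exists_isMaxOn ⟨u, mem_univ u⟩ hΦc.continuousOn
  have hhb : ∀ u, h (z u) ≤ b := fun u => (le_abs_self _).trans (hb' _ (hzIcc u))
  have hGu₀ : q u₀ ^ 2 < G₀ := by
    refine hz.gradient_lt_of_isMax hI hh hh_pos hκ hΓ hf hφ hψ hc hs hr hm hC hL (hzIoo u₀)
      (hbounds u₀) (hhb u₀) (hmin₁ (hzIcc u₀)) ?_ ?_ fun u' => hmax (mem_univ u')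
    · have h1 := neg_le_of_abs_le (hB _ (hzIcc u₀))
      have h2 : L + 1 + C + B ≤ K * deriv h (z u₀) := by
        have h3 : K * deriv h t₂ = L + 1 + C + B := div_mul_cancel₀ _ hd₂.ne'
        rw [← h3]
        exact mul_le_mul_of_nonneg_left (hmin₂ (hzIcc u₀)) hK0
      simp only [Pi.mul_apply] at h1
      linarith
    · rw [hL_def, div_mul_cancel₀ _ hf1.ne']
      linarith
  have hΦ : Real.log (1 + q u ^ 2) ≤ Real.log (1 + G₀) + 4 * (K * R) := by
    have h1 : Real.log (1 + q u ^ 2) / 2 + K * r (z u)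
        ≤ Real.log (1 + q u₀ ^ 2) / 2 + K * r (z u₀) := hmax (mem_univ u)
    have h2 : Real.log (1 + q u₀ ^ 2) ≤ Real.log (1 + G₀) :=
      Real.log_le_log (by positivity) (by linarith)
    have h3 : K * r (z u₀) ≤ K * R :=
      mul_le_mul_of_nonneg_left ((le_abs_self _).trans (hR _ (hzIcc u₀))) hK0
    have h4 : K * -R ≤ K * r (z u) :=
      mul_le_mul_of_nonneg_left (neg_le_of_abs_le (hR _ (hzIcc u))) hK0
    linarith
  have hqu : 1 + q u ^ 2 ≤ (1 + G₀) * Real.exp (4 * (K * R)) := by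
    have h1 := Real.exp_le_exp.2 hΦ
    rwa [Real.exp_add, Real.exp_log (by positivity), Real.exp_log (by positivity)] at h1
  have hhu := hh_pos _ (hz.mem u)
  have hgq : gradientNorm g z u = h (z u) * q u := (mul_div_cancel₀ _ hhu.ne').symm
  calc gradientNorm g z u = h (z u) * q u := hgq
    _ ≤ h (z u) * ((1 + G₀) * Real.exp (4 * (K * R))) := by
        gcongr
        -- `q ≤ 1 + q²` suffices, so no square root is taken.
        nlinarith [sq_nonneg (q u - 1)]
    _ ≤ b * ((1 + G₀) * Real.exp (4 * (K * R))) := by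
        gcongr
        exact hhb u
    _ < _ := lt_add_one _
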